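/- Let $\eta(\tau)=e^{2\pi i\tau/24}\prod_{k\ge 1}(1-e^{2\pi i k\tau})$ be the Dedekind eta function on the upper half-plane, and let $\chi$ be its multiplier system of weight $1/2$ on $\mathrm{SL}_2(\mathbb{Z})$, defined by $$\eta(\gamma\tau)=\chi(\gamma)\sqrt{c\tau+d}\;\eta(\tau),\qquad \gamma=\begin{pmatrix}a&b\\c&d\end{pmatrix}\in \mathrm{SL}_2(\mathbb{Z}),$$ with the principal branch of the square root (argument in $(-\pi,\pi]$). For integers $m,n$ and $c\ge 1$ let $$S(m,n,c,\chi)=\sum_{\substack{0\le a,d<c\\ \gamma=\left(\begin{smallmatrix}a&b\\c&d\end{smallmatrix}\right)\in \mathrm{SL}_2(\mathbb{Z})}}\overline{\chi(\gamma)}\;e\!\left(\frac{(m-\frac{23}{24})\,a+(n-\frac{23}{24})\,d}{c}\right),\qquad e(x)=e^{2\pi i x}.$$ There is an absolute constant $C>0$ such that the following holds. Let $m,n\in\mathbb{Z}$, and write $24n-23=N$ and $24m-23=v^2M$ with $v,M\in\mathbb{Z}$ and $M$ squarefree (possibly negative). Then for every integer $c\ge 1$, $$|S(m,n,c,\chi)|\le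 C\,\tau\big((v,c)\big)\,\tau(c)\,(MN,c)^{1/2}\,\sqrt{c},$$ where $\tau(k)$ is the number of positive divisors of $k$ and $(x,y)$ is the positive greatest common divisor. -/

import Mathlib

open scoped MatrixGroups

noncomputable section

/-- The quotient `η(γτ) / (√(cτ + d) η(τ))` for `γ = (a b; c d) ∈ SL₂(ℤ)`, with `η` the Dedekind
eta function `η(τ) = e^{2πiτ/24} ∏_{n ≥ 1} (1 - e^{2πinτ})` and the principal square root
(argument in `(-π, π]`). -/
def etaQuotient (γ : SL(2, ℤ)) (τ : UpperHalfPlane) : ℂ :=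
  ModularForm.eta (↑(γ • τ) : ℂ) /
    (Complex.sqrt ((γ 1 0 : ℂ) * (τ : ℂ) + (γ 1 1 : ℂ)) * ModularForm.eta (τ : ℂ))

/-- The multiplier system `χ` of weight `1/2` of the Dedekind eta function, defined by
`η(γτ) = χ(γ) √(cτ + d) η(τ)`. The defining quotient does not depend on `τ`
(see `eta_smul_eq_etaMultiplier`), and is evaluated at `τ = i`. -/
def etaMultiplier (γ : SL(2, ℤ)) : ℂ := etaQuotient γ UpperHalfPlane.I

theorem cocycle_ne_zero (γ : SL(2, ℤ)) (τ : UpperHalfPlane) :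
    (γ 1 0 : ℂ) * (τ : ℂ) + (γ 1 1 : ℂ) ≠ 0 := by
  simpa [UpperHalfPlane.denom] using UpperHalfPlane.denom_ne_zero (γ : GL (Fin 2) ℝ) τ

theorem sqrt_pow_twentyfour {z : ℂ} (hz : z ≠ 0) : Complex.sqrt z ^ 24 = z ^ 12 := by
  rw [sqrt_eq_exp hz, ← Complex.exp_nat_mul,
    show ((24 : ℕ) : ℂ) * (Complex.log z / 2) = (12 : ℕ) * Complex.log z by push_cast; ring,
    Complex.exp_nat_mul, Complex.exp_log hz]

theorem etaQuotient_pow (γ : SL(2, ℤ)) (τ : UpperHalfPlane) : etaQuotient γ τ ^ 24 = 1 := by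
  have hz := cocycle_ne_zero γ τ
  have hη : ModularForm.eta (τ : ℂ) ≠ 0 := ModularForm.eta_ne_zero τ.2
  have hΔ : ModularForm.discriminant (γ • τ) =
      ((γ 1 0 : ℂ) * (τ : ℂ) + (γ 1 1 : ℂ)) ^ 12 * ModularForm.discriminant τ := by
    have h := congrFun (SlashInvariantForm.slash_action_generators_SL2Z
      ModularForm.discriminant_S_invariant ModularForm.discriminant_T_invariant γ) τ
    rw [ModularForm.SL_slash_apply] at h
    rw [← h]
    simp only [UpperHalfPlane.denom]
    simp
    field_simp
  simp only [ModularForm.discriminant] at hΔ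
  rw [etaQuotient, div_pow, mul_pow, sqrt_pow_twentyfour hz, hΔ, div_self]
  exact mul_ne_zero (pow_ne_zero _ hz) (pow_ne_zero _ hη)

theorem continuous_etaQuotient (γ : SL(2, ℤ)) : Continuous (etaQuotient γ) := by
  have hη : Continuous fun τ : UpperHalfPlane => ModularForm.eta (τ : ℂ) := by
    rw [continuous_iff_continuousAt]
    intro τ
    exact (ModularForm.differentiableAt_eta_of_mem_upperHalfPlaneSet τ.2).continuousAt.comp
      UpperHalfPlane.continuous_coe.continuousAt
  have hs : Continuous fun τ : UpperHalfPlane =>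
      Complex.sqrt ((γ 1 0 : ℂ) * (τ : ℂ) + (γ 1 1 : ℂ)) := by
    by_cases hc : γ 1 0 = 0
    · simp only [hc, Int.cast_zero, zero_mul, zero_add]
      exact continuous_const
    · rw [continuous_iff_continuousAt]
      intro τ
      have hmem : (γ 1 0 : ℂ) * (τ : ℂ) + (γ 1 1 : ℂ) ∈ Complex.slitPlane := by
        right
        simpa using ⟨hc, τ.im_ne_zero⟩
      simp only [Complex.sqrt]
      exact ContinuousAt.cpow (by fun_prop) continuousAt_const hmem
  refine Continuous.div (hη.comp (continuous_const_smul (γ : GL (Fin 2) ℝ))) (hs.mul hη) fun τ => ?_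
  refine mul_ne_zero (fun h => cocycle_ne_zero γ τ ?_) (ModularForm.eta_ne_zero τ.2)
  have h24 := sqrt_pow_twentyfour (cocycle_ne_zero γ τ)
  rw [h, zero_pow (by norm_num)] at h24
  exact (pow_eq_zero_iff (by norm_num)).mp h24.symm

/-- The transformation law `η(γτ) = χ(γ) √(cτ + d) η(τ)` that defines `χ`. -/
theorem eta_smul_eq_etaMultiplier (γ : SL(2, ℤ)) (τ : UpperHalfPlane) :
    ModularForm.eta (↑(γ • τ) : ℂ) = etaMultiplier γ *
      Complex.sqrt ((γ 1 0 : ℂ) * (τ : ℂ) + (γ 1 1 : ℂ)) * ModularForm.eta (τ : ℂ) := by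
  have hfin : {z : ℂ | z ^ 24 = 1}.Finite := by
    refine (Polynomial.nthRoots 24 (1 : ℂ)).toFinset.finite_toSet.subset fun z hz => ?_
    simpa [Polynomial.mem_nthRoots] using hz
  have hconst : etaQuotient γ τ = etaMultiplier γ :=
    isPreconnected_univ.constant_of_mapsTo (hfin.isDiscrete)
      (continuous_etaQuotient γ).continuousOn (fun τ _ => etaQuotient_pow γ τ)
      (Set.mem_univ _) (Set.mem_univ _)
  have h0 := etaQuotient_pow γ τ
  rw [← hconst, mul_assoc]
  rw [etaQuotient] at h0 ⊢
  refine (div_mul_cancel₀ _ fun h => ?_).symm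
  rw [h, div_zero] at h0
  norm_num at h0

/-- The matrices `(a b; c d) ∈ SL₂(ℤ)` with the given lower left entry `c` and `0 ≤ a, d < c`. -/
def kloostermanMatrices (c : ℕ) : Set SL(2, ℤ) :=
  {γ | γ 1 0 = (c : ℤ) ∧ 0 ≤ γ 0 0 ∧ γ 0 0 < (c : ℤ) ∧ 0 ≤ γ 1 1 ∧ γ 1 1 < (c : ℤ)}

theorem finite_kloostermanMatrices (c : ℕ) : (kloostermanMatrices c).Finite := by
  refine Set.Finite.of_finite_image (f := fun γ : SL(2, ℤ) => (γ 0 0, γ 1 1)) ?_ ?_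
  · refine ((Set.finite_Ico (0 : ℤ) c).prod (Set.finite_Ico (0 : ℤ) c)).subset ?_
    rintro _ ⟨γ, ⟨-, h1, h2, h3, h4⟩, rfl⟩
    exact ⟨⟨h1, h2⟩, ⟨h3, h4⟩⟩
  · rintro γ ⟨h0, h1, h2, -, -⟩ δ ⟨k0, -, -, -, -⟩ h
    obtain ⟨ha, hd⟩ := Prod.mk.inj h
    have e1 := Matrix.SpecialLinearGroup.det_coe γ
    have e2 := Matrix.SpecialLinearGroup.det_coe δ
    rw [Matrix.det_fin_two] at e1 e2
    have hb : γ 0 1 = δ 0 1 := by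
      have hc : (c : ℤ) ≠ 0 := by omega
      apply mul_right_cancel₀ hc
      rw [h0, ha, hd] at e1
      rw [k0] at e2
      linarith
    ext i j
    fin_cases i <;> fin_cases j
    · exact ha
    · exact hb
    · exact h0.trans k0.symm
    · exact hd

/-- The Kloosterman sum `S(m, n, c, χ) = ∑ conj(χ(γ)) e((m̃ a + ñ d) / c)` of the eta multiplier,
over `γ = (a b; c d) ∈ SL₂(ℤ)` with `0 ≤ a, d < c`, where `e(x) = exp(2πix)` and
`m̃ = m - 23/24`, `ñ = n - 23/24`. -/
def etaKloostermanSum (m n : ℤ) (c : ℕ) : ℂ :=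
  ∑ γ ∈ (finite_kloostermanMatrices c).toFinset,
    (starRingEnd ℂ) (etaMultiplier γ) *
      Complex.exp (2 * Real.pi * Complex.I *
        ((((m : ℂ) - 23 / 24) * (γ 0 0 : ℂ) + ((n : ℂ) - 23 / 24) * (γ 1 1 : ℂ)) / (c : ℂ)))

end

/-!
The proof is elementary: no bound for Kloosterman sums over finite fields enters.

Euler's pentagonal number theorem gives the theta series `2 η(τ) = ∑ (12/x) e(x² τ / 24)`
(`hasSum_kroneckerTwelve_theta`). Poisson summation near the cusp `-d / c` (`hasSum_eta_at_cusp`),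
compared with the transformation law of `η` and with the uniqueness of the coefficients of a theta
series (`eq_zero_of_hasSum_exp_neg_sq`), expresses the multiplier `χ(γ)` through a quadratic Gauss sum
modulo `12c`, with one identity for each index `w` (`etaMultiplier_mul_cuspGaussSum`). Galois conjugation
`e(1/24c) ↦ e(K/24c)` with `K ≡ 1 mod 24` fixes the values of `χ`, which are 24th roots of unity, and twists
the Gauss sum by `K` (`exists_cuspGaussSum_eq_mul_conj_etaMultiplier`). So `conj χ(γ)` can be opened as a
Gauss sum with two free parameters `K` and `w`. The Kloosterman sum then becomes a sum over `r` modulo `12c`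
of ordinary Kloosterman sums modulo `c` with coefficients `(v² M - K w²) / 24` and `(N - K r²) / 24`
(`exists_etaKloostermanSum_eq`).

Write `c = c₁ c₂` with `c₁` prime to `M` and every prime factor of `c₂` dividing `M`; as `M ≡ 1 mod 24`, the
number `c₂` is prime to `6`. Choose `K ≡ M`, `w ≡ v` modulo `24 c₁`, and `K ≡ 1`, `w ≡ 0` modulo `c₂`. The sum
factors (`theta_kloosterman_sum_factor`), as follows.

* Modulo `c₁` the first coefficient vanishes, so the Kloosterman sums are Ramanujan sums. They restrict
  `r` to the solutions of `K r² ≡ N` modulo `24δ`, for `δ ∣ c₁`, and the linear phase in `r` makes the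
  contribution of `δ` vanish unless `c₁ / δ` divides `v`. Counting square roots yields the factor
  `τ((v, c₁)) τ(c₁) (N, c₁)^{1/2}` (`norm_theta_ramanujan_sum_le`).
* Modulo `c₂` there is no linear phase in `r`, and the sum is of Salié type. Substituting `u ↦ u (1 + s)²`
  for the summation variable leaves the Gauss sum over `r` alone, and confines `u` to the solutions of a
  quadratic congruence (`exists_norm_salieSum_le`). Only a squarefree factor `r₁` of `c₂` escapes this
  argument; it divides `M`, because all primes dividing `c₂` do, and so it is absorbed by the factor
  `(M N, c)^{1/2}`.
-/

/-! ### The theta series of the eta function -/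

open Filter Topology in
/-- Euler's pentagonal number theorem in the open unit disc. -/
theorem tprod_one_sub_pow_eq_tsum_pentagonal {x : ℂ} (hx : ‖x‖ < 1) :
    ∏' n : ℕ, (1 - x ^ (n + 1)) =
      ∑' k : ℕ, (-1) ^ k * (x ^ pentagonal (-k) - x ^ pentagonal (k + 1)) := by
  have h0 := norm_nonneg x
  set B : ℝ := Real.exp (1 - ‖x‖)⁻¹
  have hprod (k n : ℕ) : ‖∏ i ∈ Finset.range (n + 1), (1 - x ^ (k + i + 1))‖ ≤ B := by
    rw [norm_prod]
    calc _ ≤ ∏ i ∈ Finset.range (n + 1), (1 + ‖x‖ ^ i) := by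
          refine Finset.prod_le_prod (fun _ _ => norm_nonneg _) fun i _ => ?_
          refine (norm_sub_le _ _).trans ?_
          rw [norm_one, norm_pow]
          exact add_le_add_right (pow_le_pow_of_le_one h0 hx.le (show i ≤ k + i + 1 by omega)) 1
      _ ≤ Real.exp (∑ i ∈ Finset.range (n + 1), ‖x‖ ^ i) :=
          Real.prod_one_add_le_exp_sum _ fun i => by positivity
      _ ≤ B := by
          refine Real.exp_le_exp.mpr ?_
          rw [← tsum_geometric_of_lt_one h0 hx]
          exact (summable_geometric_of_lt_one h0 hx).sum_le_tsum _ fun _ _ => by positivity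
  have hterm (k n : ℕ) : ‖x ^ ((k + 1) * n) * ∏ i ∈ Finset.range (n + 1), (1 - x ^ (k + i + 1))‖ ≤
      ‖x‖ ^ n * B := by
    rw [norm_mul, norm_pow]
    exact mul_le_mul (pow_le_pow_of_le_one h0 hx.le (show n ≤ (k + 1) * n by nlinarith))
      (hprod k n) (norm_nonneg _) (by positivity)
  have hgeo : Summable fun n : ℕ => ‖x‖ ^ n * B :=
    (summable_geometric_of_lt_one h0 hx).mul_right B
  have hpent (k : ℤ) : k.natAbs ≤ pentagonal k + 1 := by
    have := two_mul_natCast_pentagonal k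
    zify
    rcases abs_cases k with ⟨h, _⟩ | ⟨h, _⟩ <;> rw [h] <;> nlinarith
  have hpow0 : Tendsto (fun n : ℕ => ‖x‖ ^ n) atTop (𝓝 0) := tendsto_pow_atTop_nhds_zero_of_lt_one h0 hx
  refine Pentagonal.tprod_one_sub_pow (tendsto_pow_atTop_nhds_zero_of_norm_lt_one hx) ?_ ?_ ?_ ?_
  · exact fun k => Summable.of_norm_bounded hgeo (hterm k)
  · intro k
    have := multipliable_one_add_of_summable (f := fun n : ℕ ↦ -x ^ (n + k + 1)) (by
      simpa [add_assoc] using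
        (summable_nat_add_iff (k + 1)).mpr (summable_geometric_of_lt_one h0 hx))
    simpa [sub_eq_add_neg] using this
  · rw [← summable_nat_add_iff 1]
    refine Summable.of_norm_bounded
      (g := fun k : ℕ => 2 * ‖x‖ ^ k) ((summable_geometric_of_lt_one h0 hx).mul_left 2) fun k => ?_
    rw [norm_mul, norm_pow, norm_neg, norm_one, one_pow, one_mul, two_mul]
    refine (norm_sub_le _ _).trans ?_
    rw [norm_pow, norm_pow]
    have h1 := hpent (-((k + 1 : ℕ) : ℤ))
    have h2 := hpent (((k + 1 : ℕ) : ℤ) + 1)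
    exact add_le_add (pow_le_pow_of_le_one h0 hx.le (by omega))
      (pow_le_pow_of_le_one h0 hx.le (by omega))
  · refine squeeze_zero_norm (a := fun k : ℕ => ‖x‖ ^ k * ∑' n : ℕ, ‖x‖ ^ n * B) (fun k => ?_) ?_
    · rw [norm_mul, norm_mul, norm_pow, norm_neg, norm_one, one_pow, one_mul, norm_pow]
      have : k ≤ (k + 1) * (3 * k + 4) / 2 := by
        rw [Nat.le_div_iff_mul_le (by norm_num)]
        nlinarith
      have hs := tsum_of_norm_bounded hgeo.hasSum (hterm k)
      exact mul_le_mul (pow_le_pow_of_le_one h0 hx.le this) hs (norm_nonneg _) (by positivity)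
    · simpa using hpow0.mul_const (∑' n : ℕ, ‖x‖ ^ n * B)

/-- The Kronecker symbol `(12/x)`, the even primitive Dirichlet character modulo `12`, as an
integer-valued function on the integers. -/
def kroneckerTwelve (x : ℤ) : ℤ :=
  if x % 12 = 1 ∨ x % 12 = 11 then 1 else if x % 12 = 5 ∨ x % 12 = 7 then -1 else 0

theorem kroneckerTwelve_congr {x y : ℤ} (h : x ≡ y [ZMOD 12]) :
    kroneckerTwelve x = kroneckerTwelve y := by
  rw [Int.ModEq] at h
  rw [kroneckerTwelve, kroneckerTwelve, h]

theorem kroneckerTwelve_neg (x : ℤ) : kroneckerTwelve (-x) = kroneckerTwelve x := by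
  unfold kroneckerTwelve
  have : x % 12 < 12 ∧ 0 ≤ x % 12 := ⟨Int.emod_lt_of_pos _ (by norm_num), Int.emod_nonneg _ (by norm_num)⟩
  split_ifs <;> omega

theorem kroneckerTwelve_mul (x y : ℤ) :
    kroneckerTwelve (x * y) = kroneckerTwelve x * kroneckerTwelve y := by
  have key : ∀ a ∈ Finset.Ico (0 : ℤ) 12, ∀ b ∈ Finset.Ico (0 : ℤ) 12,
      kroneckerTwelve (a * b) = kroneckerTwelve a * kroneckerTwelve b := by decide
  have hm (z : ℤ) : z % 12 ∈ Finset.Ico (0 : ℤ) 12 := by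
    rw [Finset.mem_Ico]; omega
  have hz (z : ℤ) : z ≡ z % 12 [ZMOD 12] := (Int.mod_modEq z 12).symm
  rw [kroneckerTwelve_congr ((hz x).mul (hz y)), key _ (hm x) _ (hm y),
    ← kroneckerTwelve_congr (hz x), ← kroneckerTwelve_congr (hz y)]

theorem abs_kroneckerTwelve_le_one (x : ℤ) : |kroneckerTwelve x| ≤ 1 := by
  unfold kroneckerTwelve
  split_ifs <;> simp

theorem kroneckerTwelve_sq_of_ne_zero {x : ℤ} (h : kroneckerTwelve x ≠ 0) :
    kroneckerTwelve x ^ 2 = 1 := by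
  unfold kroneckerTwelve at *
  split_ifs at * <;> simp_all

theorem sq_modEq_one_of_kroneckerTwelve_ne_zero {x : ℤ} (h : kroneckerTwelve x ≠ 0) :
    x ^ 2 ≡ 1 [ZMOD 24] := by
  have h' : x % 12 = 1 ∨ x % 12 = 11 ∨ x % 12 = 5 ∨ x % 12 = 7 := by
    unfold kroneckerTwelve at h
    split_ifs at h <;> tauto
  have : x % 24 = 1 ∨ x % 24 = 13 ∨ x % 24 = 11 ∨ x % 24 = 23 ∨ x % 24 = 5 ∨ x % 24 = 17 ∨
    x % 24 = 7 ∨ x % 24 = 19 := by omega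
  rcases this with h | h | h | h | h | h | h | h <;> simp [Int.ModEq, pow_two, Int.mul_emod, h]

theorem kroneckerTwelve_ne_zero_of_isCoprime {x : ℤ} (h : IsCoprime x 24) :
    kroneckerTwelve x ≠ 0 := by
  have h2 : ¬ (2 : ℤ) ∣ x := fun hd => by
    have := h.isUnit_of_dvd' hd (by norm_num)
    rw [Int.isUnit_iff] at this; omega
  have h3 : ¬ (3 : ℤ) ∣ x := fun hd => by
    have := h.isUnit_of_dvd' hd (by norm_num)
    rw [Int.isUnit_iff] at this; omega
  unfold kroneckerTwelve
  split_ifs <;> omega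

theorem kroneckerTwelve_six_mul_add_one (k : ℕ) :
    kroneckerTwelve (6 * k + 1) = (-1) ^ k := by
  rcases Nat.even_or_odd k with h | h
  · rw [h.neg_one_pow]; obtain ⟨j, rfl⟩ := h
    unfold kroneckerTwelve; rw [if_pos]; omega
  · rw [h.neg_one_pow]; obtain ⟨j, rfl⟩ := h
    unfold kroneckerTwelve; rw [if_neg, if_pos] <;> omega

theorem kroneckerTwelve_six_mul_add_five (k : ℕ) :
    kroneckerTwelve (6 * k + 5) = -(-1) ^ k := by
  rcases Nat.even_or_odd k with h | h
  · rw [h.neg_one_pow]; obtain ⟨j, rfl⟩ := h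
    unfold kroneckerTwelve; rw [if_neg, if_pos] <;> omega
  · rw [h.neg_one_pow]; obtain ⟨j, rfl⟩ := h
    unfold kroneckerTwelve; rw [if_pos] <;> omega

theorem summable_kroneckerTwelve_theta {τ : ℂ} (hτ : 0 < τ.im) :
    Summable fun x : ℤ => (kroneckerTwelve x : ℂ) * Complex.exp (2 * Real.pi * Complex.I * (x ^ 2 * τ / 24)) := by
  have h := (HurwitzZeta.hasSum_int_evenKernel 0 (t := τ.im / 12) (by positivity)).summable
  refine Summable.of_norm_bounded h fun x => ?_
  rw [norm_mul, Complex.norm_exp]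
  have h1 : ‖(kroneckerTwelve x : ℂ)‖ ≤ 1 := by
    rw [Complex.norm_intCast]; exact_mod_cast abs_kroneckerTwelve_le_one x
  have h2 : (2 * Real.pi * Complex.I * (x ^ 2 * τ / 24)).re = -Real.pi * (x + 0) ^ 2 * (τ.im / 12) := by
    have : 2 * Real.pi * Complex.I * (x ^ 2 * τ / 24) = ((2 * Real.pi * (x : ℝ) ^ 2 / 24 : ℝ) : ℂ) * (Complex.I * τ) := by
      push_cast; ring
    rw [this, Complex.re_ofReal_mul]
    simp
    ring
  rw [h2]
  exact mul_le_of_le_one_left (Real.exp_pos _).le h1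

/-- The theta series of the eta function: `2 η(τ) = ∑_{x ∈ ℤ} (12/x) e(x² τ / 24)`. -/
theorem hasSum_kroneckerTwelve_theta {τ : ℂ} (hτ : 0 < τ.im) :
    HasSum (fun x : ℤ => (kroneckerTwelve x : ℂ) * Complex.exp (2 * Real.pi * Complex.I * (x ^ 2 * τ / 24)))
      (2 * ModularForm.eta τ) := by
  set F : ℤ → ℂ := fun x => (kroneckerTwelve x : ℂ) * Complex.exp (2 * Real.pi * Complex.I * (x ^ 2 * τ / 24)) with hF
  have hsum : Summable F := summable_kroneckerTwelve_theta hτ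
  have hsumN : Summable fun n : ℕ => F n := hsum.comp_injective Nat.cast_injective
  have hN : HasSum (fun n : ℕ => F n) (ModularForm.eta τ) := by
    have h6 := ((Nat.divModEquiv 6).symm.hasSum_iff.mpr hsumN.hasSum).prod_fiberwise
      (fun b => hasSum_fintype _)
    have hq : ‖Complex.exp (2 * Real.pi * Complex.I * τ)‖ < 1 := by
      rw [Complex.norm_exp]
      simp [Complex.mul_re, Complex.mul_im]
      positivity
    have hη : ModularForm.eta τ = ∑' n : ℕ, F n := by
      rw [← h6.tsum_eq, ModularForm.eta]
      simp_rw [ModularForm.eta_q_eq_pow]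
      rw [tprod_one_sub_pow_eq_tsum_pentagonal hq, ← tsum_mul_left]
      refine tsum_congr fun k => ?_
      have hz (j : ℕ) (hj : kroneckerTwelve ((k * 6 + j : ℕ) : ℤ) = 0) : F ((k * 6 + j : ℕ) : ℤ) = 0 := by
        simp only [hF, hj, Int.cast_zero, zero_mul]
      have hm (j : ℕ) (s : ℤ) (p : ℕ) (hs : kroneckerTwelve ((k * 6 + j : ℕ) : ℤ) = s)
          (hp : (24 * p + 1 : ℤ) = (6 * k + j) ^ 2) : F ((k * 6 + j : ℕ) : ℤ) =
          Function.Periodic.qParam 24 τ * (s * Complex.exp (2 * Real.pi * Complex.I * τ) ^ p) := by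
        simp only [hF, hs]
        rw [Function.Periodic.qParam, ← Complex.exp_nat_mul, mul_left_comm, ← Complex.exp_add]
        have hp' : (24 * p + 1 : ℂ) = (6 * k + j) ^ 2 := by exact_mod_cast hp
        congr 2
        push_cast
        rw [show ((k : ℂ) * 6 + j) ^ 2 = 24 * p + 1 by rw [hp']; ring]
        ring
      simp only [Function.comp, Fin.sum_univ_six, Nat.divModEquiv_symm_apply]
      change _ = F ((k * 6 + 0 : ℕ) : ℤ) + F ((k * 6 + 1 : ℕ) : ℤ) + F ((k * 6 + 2 : ℕ) : ℤ) +
        F ((k * 6 + 3 : ℕ) : ℤ) + F ((k * 6 + 4 : ℕ) : ℤ) + F ((k * 6 + 5 : ℕ) : ℤ)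
      rw [hz 0, hz 2, hz 3, hz 4, hm 1 ((-1) ^ k) (pentagonal (-k)), hm 5 (-(-1) ^ k) (pentagonal (k + 1))]
      · push_cast; ring
      · rw [← kroneckerTwelve_six_mul_add_five]; congr 1; push_cast; ring
      · have := two_mul_natCast_pentagonal (k + 1)
        push_cast; linear_combination 12 * this
      · rw [← kroneckerTwelve_six_mul_add_one]; congr 1; push_cast; ring
      · have := two_mul_natCast_pentagonal_neg k
        push_cast; linear_combination 12 * this
      all_goals
        unfold kroneckerTwelve
        rw [if_neg, if_neg] <;> omega
    rw [hη]
    exact hsumN.hasSum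
  have h0 : F 0 = 0 := by simp [hF, kroneckerTwelve]
  have hneg (n : ℤ) : F (-n) = F n := by simp [hF, kroneckerTwelve_neg]
  have := HasSum.of_nat_of_neg hN (by simpa only [hneg] using hN)
  rwa [h0, sub_zero, ← two_mul] at this

/-! ### Additive characters and sums over a period -/

/-- The additive character `a ↦ e(a / q)` of the integers, where `e(x) = exp(2πix)`. -/
noncomputable def addExp (q : ℕ) (a : ℤ) : ℂ := Complex.exp (2 * Real.pi * Complex.I * (a / q))

theorem addExp_add (q : ℕ) (a b : ℤ) : addExp q (a + b) = addExp q a * addExp q b := by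
  rw [addExp, addExp, addExp, ← Complex.exp_add]
  congr 1; push_cast; ring

theorem addExp_neg (q : ℕ) (a : ℤ) : addExp q (-a) = (addExp q a)⁻¹ := by
  rw [addExp, addExp, ← Complex.exp_neg]
  congr 1; push_cast; ring

theorem addExp_mul_natCast (q : ℕ) (a : ℤ) (n : ℕ) : addExp q (n * a) = addExp q a ^ n := by
  rw [addExp, addExp, ← Complex.exp_nat_mul]
  congr 1; push_cast; ring

theorem norm_addExp (q : ℕ) (a : ℤ) : ‖addExp q a‖ = 1 := by
  have : addExp q a = Complex.exp (((2 * Real.pi * (a / q) : ℝ) : ℂ) * Complex.I) := by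
    rw [addExp]; congr 1; push_cast; ring
  rw [this, Complex.norm_exp_ofReal_mul_I]

theorem addExp_ne_zero (q : ℕ) (a : ℤ) : addExp q a ≠ 0 := Complex.exp_ne_zero _

theorem addExp_mul_self (q : ℕ) (a : ℤ) : addExp q (q * a) = 1 := by
  rcases eq_or_ne q 0 with rfl | hq
  · simp [addExp]
  · have : (q : ℂ) ≠ 0 := by exact_mod_cast hq
    rw [addExp, show 2 * Real.pi * Complex.I * (((q * a : ℤ) : ℂ) / q) = a * (2 * Real.pi * Complex.I) by
      push_cast; field_simp, Complex.exp_int_mul_two_pi_mul_I]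

theorem addExp_congr {q : ℕ} {a b : ℤ} (h : a ≡ b [ZMOD q]) : addExp q a = addExp q b := by
  obtain ⟨t, ht⟩ := h.dvd
  rw [show b = a + q * t by omega, addExp_add, addExp_mul_self, mul_one]

theorem addExp_mul_mul {k : ℕ} (hk : k ≠ 0) (q : ℕ) (a : ℤ) : addExp (k * q) (k * a) = addExp q a := by
  have : (k : ℂ) ≠ 0 := by exact_mod_cast hk
  rw [addExp, addExp]
  push_cast
  rw [mul_div_mul_left _ _ this]

theorem addExp_eq_stdAddChar (q : ℕ) [NeZero q] (a : ℤ) :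
    addExp q a = ZMod.stdAddChar (a : ZMod q) := by
  rw [ZMod.stdAddChar_coe, addExp, mul_div_assoc]

/-- A sum over a period of a periodic function, as a sum over `ZMod q`. -/
theorem sum_range_eq_sum_zmod {α : Type*} [AddCommMonoid α] (q : ℕ) [NeZero q] (f : ℤ → α) :
    ∑ r ∈ Finset.range q, f r = ∑ z : ZMod q, f z.val := by
  refine (Finset.sum_bij (fun (z : ZMod q) _ => z.val) ?_ ?_ ?_ ?_).symm
  · exact fun z _ => Finset.mem_range.mpr z.val_lt
  · exact fun z _ z' _ h => ZMod.val_injective q h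
  · exact fun r hr => ⟨r, Finset.mem_univ _, ZMod.val_cast_of_lt (Finset.mem_range.mp hr)⟩
  · exact fun z _ => rfl

theorem sum_range_neg_of_periodic {α : Type*} [AddCommMonoid α] {q : ℕ} {f : ℤ → α}
    (hf : ∀ a b : ℤ, a ≡ b [ZMOD q] → f a = f b) :
    ∑ r ∈ Finset.range q, f (-r) = ∑ r ∈ Finset.range q, f r := by
  rcases eq_or_ne q 0 with rfl | hq
  · simp
  have : NeZero q := ⟨hq⟩
  rw [sum_range_eq_sum_zmod q f, sum_range_eq_sum_zmod q (fun a => f (-a)),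
    ← Equiv.sum_comp (Equiv.neg (ZMod q)) (fun z => f z.val)]
  refine Finset.sum_congr rfl fun z _ => hf _ _ ?_
  rw [← ZMod.intCast_eq_intCast_iff]
  simp

/-! ### The multiplier as a Gauss sum -/

open Filter Topology in
/-- Coefficients of a theta series in `exp(-πk²y)` are unique: an even bounded coefficient sequence
whose theta series vanishes identically is zero. -/
theorem eq_zero_of_hasSum_exp_neg_sq {D : ℤ → ℂ} {B : ℝ} (hB : ∀ k, ‖D k‖ ≤ B)
    (heven : ∀ k, D (-k) = D k)
    (h : ∀ y : ℝ, 0 < y → HasSum (fun k : ℤ => D k * (Real.exp (-Real.pi * k ^ 2 * y) : ℂ)) 0)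
    (k : ℤ) : D k = 0 := by
  have hB0 : 0 ≤ B := (norm_nonneg _).trans (hB 0)
  suffices key : ∀ n : ℕ, D n = 0 by
    rcases Int.eq_nat_or_neg k with ⟨n, rfl | rfl⟩
    · exact key n
    · rw [heven]; exact key n
  intro n
  induction n using Nat.strong_induction_on with
  | _ n ih =>
  have ih' (j : ℤ) (hj : j ^ 2 < (n : ℤ) ^ 2) : D j = 0 := by
    have hlt : j.natAbs < n := by
      have := sq_lt_sq.mp hj
      rw [Nat.abs_cast, Int.abs_eq_natAbs] at this
      omega
    rcases Int.natAbs_eq j with hj' | hj'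
    · rw [hj']; exact ih _ hlt
    · rw [hj', heven]; exact ih _ hlt
  -- Multiply by `exp(πn²y)`; as `y → ∞` only the terms with `k = ±n` survive.
  let T : ℝ → ℤ → ℂ := fun y j => D j * (Real.exp (-Real.pi * ((j : ℝ) ^ 2 - (n : ℝ) ^ 2) * y) : ℂ)
  have hT0 (y : ℝ) (hy : 0 < y) : ∑' j, T y j = 0 := by
    have := (h y hy).mul_right ((Real.exp (Real.pi * (n : ℝ) ^ 2 * y) : ℝ) : ℂ)
    rw [zero_mul] at this
    rw [← this.tsum_eq]
    refine tsum_congr fun j => ?_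
    simp only [T]
    rw [mul_assoc (D j), ← Complex.ofReal_mul, ← Real.exp_add]
    congr 3
    ring
  have hlim : Tendsto (fun y => ∑' j, T y j) atTop
      (𝓝 (∑' j : ℤ, if j ^ 2 = (n : ℤ) ^ 2 then D j else 0)) := by
    have hs := (HurwitzZeta.hasSum_int_evenKernel 0 (t := 1) one_pos).summable
    refine tendsto_tsum_of_dominated_convergence
      (bound := fun j : ℤ => B * Real.exp (Real.pi * (n : ℝ) ^ 2) *
        Real.exp (-Real.pi * ((j : ℝ) + 0) ^ 2 * 1)) (hs.mul_left _) ?_ ?_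
    · intro j
      by_cases h1 : j ^ 2 = (n : ℤ) ^ 2
      · rw [if_pos h1]
        have h1' : (j : ℝ) ^ 2 = (n : ℝ) ^ 2 := by exact_mod_cast h1
        refine tendsto_const_nhds.congr fun y => ?_
        simp only [T, h1', sub_self, mul_zero, zero_mul, Real.exp_zero, Complex.ofReal_one, mul_one]
      · rw [if_neg h1]
        rcases lt_or_gt_of_ne h1 with h2 | h2
        · refine tendsto_const_nhds.congr fun y => ?_
          simp [T, ih' j h2]
        · have h2' : (n : ℝ) ^ 2 < (j : ℝ) ^ 2 := by exact_mod_cast h2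
          have hneg : -Real.pi * ((j : ℝ) ^ 2 - (n : ℝ) ^ 2) < 0 := by
            have := Real.pi_pos; nlinarith
          have hexp : Tendsto (fun y : ℝ => Real.exp (-Real.pi * ((j : ℝ) ^ 2 - (n : ℝ) ^ 2) * y))
              atTop (𝓝 0) :=
            Real.tendsto_exp_atBot.comp (tendsto_id.const_mul_atTop_of_neg hneg)
          have := (Complex.continuous_ofReal.tendsto 0).comp hexp
          simpa [T] using this.const_mul (D j)
    · filter_upwards [eventually_ge_atTop 1] with y hy j
      rw [norm_mul, Complex.norm_real, Real.norm_eq_abs, abs_of_pos (Real.exp_pos _), mul_assoc B,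
        ← Real.exp_add]
      rcases lt_or_ge (j ^ 2) ((n : ℤ) ^ 2) with h2 | h2
      · rw [ih' j h2, norm_zero, zero_mul]; positivity
      · refine mul_le_mul (hB j) (Real.exp_le_exp.mpr ?_) (Real.exp_pos _).le hB0
        have h2' : (n : ℝ) ^ 2 ≤ (j : ℝ) ^ 2 := by exact_mod_cast h2
        have hp : 0 ≤ Real.pi * ((j : ℝ) ^ 2 - (n : ℝ) ^ 2) :=
          mul_nonneg Real.pi_pos.le (by linarith)
        nlinarith
  have hzero : ∑' j : ℤ, (if j ^ 2 = (n : ℤ) ^ 2 then D j else 0) = 0 := by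
    refine tendsto_nhds_unique hlim (tendsto_const_nhds.congr' ?_)
    filter_upwards [eventually_gt_atTop 0] with y hy
    exact (hT0 y hy).symm
  rw [tsum_eq_sum (s := {(n : ℤ), -(n : ℤ)}) (fun j hj => if_neg fun hj' => hj (by
    rcases sq_eq_sq_iff_eq_or_eq_neg.mp hj' with h | h <;> simp [h]))] at hzero
  rcases eq_or_ne n 0 with rfl | hn
  · simpa using hzero
  · rw [Finset.sum_pair (by omega), neg_sq, if_pos rfl, if_pos rfl, heven, ← two_mul] at hzero
    simpa using hzero

/-- The quadratic Gauss sum `∑_{r mod 12c} (12/r) e(k (-d r² + 2 w r) / 24c)`; for `k = 1` it is the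
coefficient of index `w` in the theta expansion of the eta function at the cusp `-d / c`. -/
noncomputable def cuspGaussSum (c : ℕ) (k d w : ℤ) : ℂ :=
  ∑ r ∈ Finset.range (12 * c), (kroneckerTwelve r : ℂ) * addExp (24 * c) (k * (-d * r ^ 2 + 2 * w * r))

/-- The summand of `cuspGaussSum` has period `12c` in `r`, although its phase is only a fraction with
denominator `24c`. -/
theorem cuspGaussSum_term_congr {c : ℕ} (k d w : ℤ) {r s : ℤ} (h : r ≡ s [ZMOD (12 * c : ℕ)]) :
    (kroneckerTwelve r : ℂ) * addExp (24 * c) (k * (-d * r ^ 2 + 2 * w * r)) =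
      kroneckerTwelve s * addExp (24 * c) (k * (-d * s ^ 2 + 2 * w * s)) := by
  obtain ⟨t, ht⟩ := h.dvd
  obtain rfl : s = r + 12 * c * t := by push_cast at ht; linarith
  rw [kroneckerTwelve_congr (Int.modEq_iff_dvd.mpr ⟨c * t, by ring⟩ : r ≡ r + 12 * c * t [ZMOD 12])]
  congr 1
  refine addExp_congr (Int.modEq_iff_dvd.mpr ⟨k * (-d * (r * t + 6 * c * t ^ 2) + w * t), ?_⟩)
  push_cast
  ring

theorem cuspGaussSum_neg (c : ℕ) (k d w : ℤ) : cuspGaussSum c k d (-w) = cuspGaussSum c k d w := by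
  rw [cuspGaussSum, ← sum_range_neg_of_periodic (q := 12 * c)
    (f := fun r : ℤ => (kroneckerTwelve r : ℂ) * addExp (24 * c) (k * (-d * r ^ 2 + 2 * -w * r)))
    (fun a b hab => cuspGaussSum_term_congr k d (-w) hab)]
  refine Finset.sum_congr rfl fun r _ => ?_
  rw [kroneckerTwelve_neg]
  congr 2
  ring

theorem norm_cuspGaussSum_le (c : ℕ) (k d w : ℤ) : ‖cuspGaussSum c k d w‖ ≤ 12 * c := by
  refine (norm_sum_le_of_le (Finset.range (12 * c)) (f := fun r : ℕ => (kroneckerTwelve (r : ℤ) : ℂ) *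
    addExp (24 * c) (k * (-d * (r : ℤ) ^ 2 + 2 * w * r))) (n := fun _ => (1 : ℝ)) fun r _ => ?_).trans (by simp)
  rw [norm_mul, norm_addExp, mul_one, Complex.norm_intCast]
  exact_mod_cast abs_kroneckerTwelve_le_one r

/-- Poisson summation for the theta series of the eta function at the cusp `-d / c`. -/
theorem hasSum_eta_at_cusp {c : ℕ} (hc : 0 < c) (d : ℤ) {τ : ℂ} {y : ℝ} (hy : 0 < y)
    (hτ : τ = -d / c + Complex.I / (12 * c ^ 2 * y)) :
    HasSum (fun k : ℤ => (√y * cuspGaussSum c 1 d k) * (Real.exp (-Real.pi * k ^ 2 * y) : ℂ))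
      (2 * ModularForm.eta τ) := by
  have hc' : (c : ℂ) ≠ 0 := by exact_mod_cast hc.ne'
  have hcR : (0 : ℝ) < c := by exact_mod_cast hc
  have hy' : (y : ℂ) ≠ 0 := by exact_mod_cast hy.ne'
  have : NeZero (12 * c) := ⟨by omega⟩
  have him : 0 < τ.im := by
    have : τ = ((-d / c : ℝ) : ℂ) + ((1 / (12 * c ^ 2 * y) : ℝ) : ℂ) * Complex.I := by
      rw [hτ]; push_cast; ring
    rw [this, Complex.add_im, Complex.ofReal_im, Complex.im_ofReal_mul]
    simp
    positivity
  let f : ℤ → ℂ := fun r => (kroneckerTwelve r : ℂ) * addExp (24 * c) (1 * (-d * r ^ 2 + 2 * 0 * r))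
  have hterm (r : Fin (12 * c)) (m : ℤ) :
      (kroneckerTwelve (m * (12 * c : ℕ) + r) : ℂ) * Complex.exp (2 * Real.pi * Complex.I *
        (((m * (12 * c : ℕ) + r : ℤ) : ℂ) ^ 2 * τ / 24)) =
      f r * (Real.exp (-Real.pi * (m + (r / (12 * c : ℕ) : ℝ)) ^ 2 * (1 / y)) : ℂ) := by
    set x : ℤ := m * (12 * c : ℕ) + r with hx
    have hf : f r = f x := cuspGaussSum_term_congr 1 d 0
      (Int.modEq_iff_dvd.mpr ⟨m, by rw [hx]; ring⟩)
    rw [hf]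
    simp only [f]
    rw [mul_assoc (kroneckerTwelve x : ℂ), addExp, Complex.ofReal_exp, ← Complex.exp_add]
    congr 2
    have hx' : (x : ℂ) = m * (12 * c) + r := by rw [hx]; push_cast; ring
    have h2 : (m + (r / (12 * c : ℕ) : ℝ) : ℂ) = x / (12 * c) := by
      rw [hx']; push_cast; field_simp
    push_cast at h2 ⊢
    rw [h2, hτ]
    field_simp
    linear_combination (24 * x ^ 2 : ℂ) * Complex.I_sq
  have h1 := (Int.divModEquiv (12 * c)).symm.hasSum_iff.mpr (hasSum_kroneckerTwelve_theta him)
  have h2 := h1.prod_fiberwise (fun m => hasSum_fintype _)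
  have h3 : HasSum (fun m : ℤ => ∑ r : Fin (12 * c), f r *
      (Real.exp (-Real.pi * (m + (r / (12 * c : ℕ) : ℝ)) ^ 2 * (1 / y)) : ℂ)) (2 * ModularForm.eta τ) := by
    refine h2.congr_fun fun m => Finset.sum_congr rfl fun r _ => ?_
    rw [← hterm]
    simp [Int.divModEquiv_symm_apply]
  have h4 : HasSum (fun m : ℤ => ∑ r : Fin (12 * c), f r *
      (Real.exp (-Real.pi * (m + (r / (12 * c : ℕ) : ℝ)) ^ 2 * (1 / y)) : ℂ))
      (∑ r : Fin (12 * c), f r * (HurwitzZeta.evenKernel ((r / (12 * c : ℕ) : ℝ) : UnitAddCircle) (1 / y) : ℂ)) :=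
    hasSum_sum fun r _ => (Complex.hasSum_ofReal.mpr
      (HurwitzZeta.hasSum_int_evenKernel _ (by positivity))).mul_left _
  have h5 : HasSum (fun k : ℤ => ∑ r : Fin (12 * c), f r * ((√y : ℂ) *
      (Complex.exp (2 * Real.pi * Complex.I * ((r / (12 * c : ℕ) : ℝ) : ℂ) * k) * (Real.exp (-Real.pi * k ^ 2 * y) : ℂ))))
      (∑ r : Fin (12 * c), f r * (HurwitzZeta.evenKernel ((r / (12 * c : ℕ) : ℝ) : UnitAddCircle) (1 / y) : ℂ)) := by
    refine hasSum_sum fun r _ => HasSum.mul_left _ ?_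
    have hs : 1 / (1 / y) ^ (1 / 2 : ℝ) = √y := by
      rw [← Real.sqrt_eq_rpow, Real.sqrt_div' _ hy.le]; simp
    rw [HurwitzZeta.evenKernel_functional_equation, hs, one_div_one_div, Complex.ofReal_mul]
    exact (HurwitzZeta.hasSum_int_cosKernel _ hy).mul_left _
  rw [h3.unique h4]
  refine h5.congr_fun fun k => ?_
  rw [cuspGaussSum, Finset.mul_sum, Finset.sum_mul, ← Fin.sum_univ_eq_sum_range (fun r : ℕ =>
    (√y : ℂ) * ((kroneckerTwelve r : ℂ) * addExp (24 * c) (1 * (-d * (r : ℤ) ^ 2 + 2 * k * r))) *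
      (Real.exp (-Real.pi * k ^ 2 * y) : ℂ)) (12 * c)]
  refine Finset.sum_congr rfl fun r _ => ?_
  simp only [f]
  have he : addExp (24 * c) (1 * (-d * (r : ℤ) ^ 2 + 2 * k * r)) =
      addExp (24 * c) (1 * (-d * (r : ℤ) ^ 2 + 2 * 0 * r)) *
        Complex.exp (2 * Real.pi * Complex.I * ((r / (12 * c : ℕ) : ℝ) : ℂ) * k) := by
    rw [show (1 : ℤ) * (-d * (r : ℤ) ^ 2 + 2 * k * r) = 1 * (-d * (r : ℤ) ^ 2 + 2 * 0 * r) + 2 * k * r by ring,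
      addExp_add]
    congr 1
    rw [addExp]
    congr 1
    push_cast
    field_simp
    ring
  rw [he]
  ring

/-- The principal square root on the positive imaginary axis. -/
theorem sqrt_I_mul {t : ℝ} (ht : 0 < t) : Complex.sqrt (Complex.I * t) = addExp 8 1 * √t := by
  have ht' : (t : ℂ) ≠ 0 := by exact_mod_cast ht.ne'
  rw [sqrt_eq_exp (mul_ne_zero Complex.I_ne_zero ht'), mul_comm Complex.I,
    Complex.log_ofReal_mul ht Complex.I_ne_zero, Complex.log_I, Real.sqrt_eq_rpow,
    Real.rpow_def_of_pos ht, addExp, Complex.ofReal_exp, ← Complex.exp_add]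
  congr 1
  push_cast
  ring

/-- The multiplier of the eta function in terms of a Gauss sum:
`(12/w) e(a w² / 24c) = χ(γ) e(1/8) (12c)^{-1/2} ∑_{r mod 12c} (12/r) e((-d r² + 2 w r) / 24c)`. -/
theorem etaMultiplier_mul_cuspGaussSum {γ : SL(2, ℤ)} {c : ℕ} (hc : 0 < c) (hγ : γ 1 0 = c) (w : ℤ) :
    (kroneckerTwelve w : ℂ) * addExp (24 * c) (γ 0 0 * w ^ 2) =
      etaMultiplier γ * (addExp 8 1 / √(12 * c)) * cuspGaussSum c 1 (γ 1 1) w := by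
  set a := γ 0 0
  set d := γ 1 1
  have hcC : (c : ℂ) ≠ 0 := by exact_mod_cast hc.ne'
  have hcR : (0 : ℝ) < c := by exact_mod_cast hc
  have hdet : (a : ℂ) * d - (γ 0 1 : ℂ) * c = 1 := by
    have h := Matrix.SpecialLinearGroup.det_coe γ
    rw [Matrix.det_fin_two, hγ] at h
    exact_mod_cast h
  let L : ℤ → ℂ := fun k => (kroneckerTwelve k : ℂ) * addExp (24 * c) (a * k ^ 2)
  let R : ℤ → ℂ := fun k => etaMultiplier γ * (addExp 8 1 / √(12 * c)) * cuspGaussSum c 1 d k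
  suffices h : L w - R w = 0 from sub_eq_zero.mp h
  refine eq_zero_of_hasSum_exp_neg_sq (D := fun k => L k - R k)
    (B := 1 + ‖etaMultiplier γ * (addExp 8 1 / √(12 * c))‖ * (12 * c)) (fun k => ?_) (fun k => ?_) ?_ w
  · refine (norm_sub_le _ _).trans (add_le_add ?_ ?_)
    · simp only [L]
      rw [norm_mul, norm_addExp, mul_one, Complex.norm_intCast]
      exact_mod_cast abs_kroneckerTwelve_le_one k
    · simp only [R]
      rw [norm_mul]
      exact mul_le_mul_of_nonneg_left (norm_cuspGaussSum_le _ _ _ _) (norm_nonneg _)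
  · simp only [L, R, kroneckerTwelve_neg, cuspGaussSum_neg, neg_sq]
  intro y hy
  have hyC : (y : ℂ) ≠ 0 := by exact_mod_cast hy.ne'
  -- The point `τ` with `γτ = a/c + 12iy`.
  let z : ℂ := -d / c + Complex.I / (12 * c ^ 2 * y)
  have hz : z = ((-d / c : ℝ) : ℂ) + ((1 / (12 * c ^ 2 * y) : ℝ) : ℂ) * Complex.I := by
    simp only [z]; push_cast; ring
  have him : 0 < z.im := by
    rw [hz, Complex.add_im, Complex.ofReal_im, Complex.im_ofReal_mul]
    simp
    positivity
  let τ : UpperHalfPlane := ⟨z, him⟩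
  have hτz : (τ : ℂ) = z := rfl
  have hden : (γ 1 0 : ℂ) * (τ : ℂ) + (γ 1 1 : ℂ) = Complex.I * ((1 / (12 * c * y) : ℝ) : ℂ) := by
    rw [hγ, hτz]
    simp only [z]
    push_cast
    field_simp
    ring
  have hsmul : (↑(γ • τ) : ℂ) = a / c + 12 * y * Complex.I := by
    have h1 := UpperHalfPlane.coe_specialLinearGroup_apply γ τ
    have h2 : (γ 1 0 : ℂ) * (τ : ℂ) + (γ 1 1 : ℂ) ≠ 0 := cocycle_ne_zero γ τ
    have h3 : (↑(γ • τ) : ℂ) = ((a : ℂ) * τ + (γ 0 1 : ℂ)) / ((γ 1 0 : ℂ) * (τ : ℂ) + (γ 1 1 : ℂ)) := by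
      rw [h1]; simp [a]
    rw [h3, hden, hτz]
    simp only [z]
    have hb : (γ 0 1 : ℂ) = (a * d - 1) / c := by
      field_simp; linear_combination -hdet
    rw [hb]
    push_cast
    field_simp
    linear_combination (-12 * c * y : ℂ) * Complex.I_sq
  have him2 : 0 < (↑(γ • τ) : ℂ).im := (γ • τ).2
  have h1 : HasSum (fun k : ℤ => L k * (Real.exp (-Real.pi * k ^ 2 * y) : ℂ))
      (2 * ModularForm.eta (↑(γ • τ) : ℂ)) := by
    refine (hasSum_kroneckerTwelve_theta him2).congr_fun fun k => ?_
    simp only [L]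
    rw [mul_assoc (kroneckerTwelve k : ℂ), addExp, Complex.ofReal_exp, ← Complex.exp_add, hsmul]
    congr 2
    push_cast
    field_simp
    linear_combination (-24 * c * y * k ^ 2 : ℂ) * Complex.I_sq
  have h2 := (hasSum_eta_at_cusp hc d hy (τ := z) rfl).mul_left
    (etaMultiplier γ * (addExp 8 1 * √(1 / (12 * c * y))))
  have h3 : HasSum (fun k : ℤ => R k * (Real.exp (-Real.pi * k ^ 2 * y) : ℂ))
      (2 * ModularForm.eta (↑(γ • τ) : ℂ)) := by
    rw [eta_smul_eq_etaMultiplier γ τ, hden, sqrt_I_mul (by positivity), hτz]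
    have h4 : √(1 / (12 * c * y)) * √y = 1 / √(12 * c) := by
      rw [← Real.sqrt_mul (by positivity), one_div (√_), ← Real.sqrt_inv]
      congr 1
      field_simp
    have h4' : ((√(1 / (12 * c * y)) : ℝ) : ℂ) * (√y : ℝ) = 1 / ((√(12 * c) : ℝ) : ℂ) := by
      exact_mod_cast congrArg (fun x : ℝ => (x : ℂ)) h4
    rw [mul_left_comm]
    refine (h2.congr_fun fun k => ?_)
    · simp only [R]
      linear_combination (-etaMultiplier γ * addExp 8 1 * cuspGaussSum c 1 d k *
        (Real.exp (-Real.pi * k ^ 2 * y) : ℂ)) * h4'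
  have := h1.sub h3
  rw [sub_self] at this
  exact this.congr_fun fun k => by ring

/-! ### Galois conjugation of the Gauss sums -/

theorem etaMultiplier_pow_twentyfour (γ : SL(2, ℤ)) : etaMultiplier γ ^ 24 = 1 := etaQuotient_pow γ _

theorem norm_etaMultiplier (γ : SL(2, ℤ)) : ‖etaMultiplier γ‖ = 1 :=
  Complex.norm_eq_one_of_pow_eq_one (etaMultiplier_pow_twentyfour γ) (by norm_num)

theorem isPrimitiveRoot_addExp_one {q : ℕ} (hq : q ≠ 0) : IsPrimitiveRoot (addExp q 1) q := by
  simpa [addExp, div_eq_mul_inv] using Complex.isPrimitiveRoot_exp q hq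

/-- The values of the multiplier are 24th roots of unity, hence fixed by `e(1/24c) ↦ e(k/24c)` when
`k ≡ 1 mod 24`. -/
theorem exists_conj_etaMultiplier_eq_addExp (γ : SL(2, ℤ)) :
    ∃ j : ℤ, (starRingEnd ℂ) (etaMultiplier γ) = addExp 24 j := by
  obtain ⟨i, -, hi⟩ := (isPrimitiveRoot_addExp_one (q := 24) (by norm_num)).eq_pow_of_pow_eq_one
    (ξ := (starRingEnd ℂ) (etaMultiplier γ)) (by
      rw [← map_pow, etaMultiplier_pow_twentyfour, map_one])
  exact ⟨i, by rw [← hi, ← addExp_mul_natCast, mul_one]⟩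

open Polynomial in
/-- An integral polynomial relation satisfied by a primitive root of unity is satisfied by its
Galois conjugates. -/
theorem aeval_pow_eq_zero_of_aeval_eq_zero {q k : ℕ} {ζ : ℂ} (hq : 0 < q) (hζ : IsPrimitiveRoot ζ q)
    (hk : k.Coprime q) {P : ℤ[X]} (hP : aeval ζ P = 0) : aeval (ζ ^ k) P = 0 := by
  obtain ⟨Q, rfl⟩ := minpoly.isIntegrallyClosed_dvd (hζ.isIntegral hq) hP
  rw [map_mul, hζ.minpoly_eq_pow_coprime hk, minpoly.aeval, zero_mul]

open Polynomial in
/-- The polynomial whose value at `e(k / 24c)` is `cuspGaussSum c k d w`. -/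
noncomputable def cuspGaussPoly (c : ℕ) (d w : ℤ) : ℤ[X] :=
  ∑ r ∈ Finset.range (12 * c), C (kroneckerTwelve r) *
    X ^ ((-d * (r : ℤ) ^ 2 + 2 * w * r) % (24 * c : ℕ)).toNat

/-- Reducing the exponent modulo `q` turns the integer `m` into a natural number, as needed for a
polynomial in the root of unity. -/
theorem addExp_pow_emod_toNat {q : ℕ} (hq : q ≠ 0) (k : ℕ) (m : ℤ) :
    (addExp q 1 ^ k) ^ (m % (q : ℕ)).toNat = addExp q (k * m) := by
  rw [← addExp_mul_natCast, ← addExp_mul_natCast]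
  refine addExp_congr ?_
  rw [Int.toNat_of_nonneg (Int.emod_nonneg _ (by exact_mod_cast hq)), mul_one, mul_comm]
  exact (Int.mod_modEq m q).mul_left _

open Polynomial in
theorem aeval_cuspGaussPoly {c : ℕ} (hc : 0 < c) (k : ℕ) (d w : ℤ) :
    aeval (addExp (24 * c) 1 ^ k) (cuspGaussPoly c d w) = cuspGaussSum c k d w := by
  rw [cuspGaussPoly, cuspGaussSum, map_sum]
  refine Finset.sum_congr rfl fun r _ => ?_
  rw [map_mul, map_pow, aeval_X, aeval_C, addExp_pow_emod_toNat (by omega)]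
  simp

/-- The Gauss sum at a cusp in terms of the multiplier of the eta function. -/
theorem cuspGaussSum_one_eq {γ : SL(2, ℤ)} {c : ℕ} (hc : 0 < c) (hγ : γ 1 0 = c) (w : ℤ) :
    cuspGaussSum c 1 (γ 1 1) w = √(12 * c) * addExp 8 (-1) * (starRingEnd ℂ) (etaMultiplier γ) *
      kroneckerTwelve w * addExp (24 * c) (γ 0 0 * w ^ 2) := by
  have h := etaMultiplier_mul_cuspGaussSum hc hγ w
  have hcR : (0 : ℝ) < c := by exact_mod_cast hc
  have hs : ((√(12 * c) : ℝ) : ℂ) ≠ 0 := by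
    exact_mod_cast (Real.sqrt_pos.mpr (by positivity)).ne'
  have hχ : (starRingEnd ℂ) (etaMultiplier γ) * etaMultiplier γ = 1 := by
    rw [← Complex.normSq_eq_conj_mul_self, Complex.normSq_eq_norm_sq, norm_etaMultiplier]
    simp
  have h8 := addExp_ne_zero 8 1
  rw [mul_assoc _ (kroneckerTwelve w : ℂ), h, addExp_neg]
  field_simp
  linear_combination (-cuspGaussSum c 1 (γ 1 1) w) * hχ

open Polynomial in
/-- Galois conjugation of two Gauss sums at cusps by `e(1/24c) ↦ e(k/24c)` with `k ≡ 1 mod 24`, which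
fixes the values of the multiplier. -/
theorem cuspGaussSum_mul_cuspGaussSum {γ γ₀ : SL(2, ℤ)} {c k : ℕ} (hc : 0 < c) (hk : k.Coprime (24 * c))
    (hk1 : (k : ℤ) ≡ 1 [ZMOD 24]) (hγ : γ 1 0 = c) (hγ₀ : γ₀ 1 0 = c) (w : ℤ) :
    cuspGaussSum c k (γ 1 1) w * cuspGaussSum c k (γ₀ 1 1) 1 =
      12 * c * addExp 8 (-2) * (starRingEnd ℂ) (etaMultiplier γ) * (starRingEnd ℂ) (etaMultiplier γ₀) *
        kroneckerTwelve w * addExp (24 * c) (k * (γ 0 0 * w ^ 2)) * addExp (24 * c) (k * γ₀ 0 0) := by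
  obtain ⟨j, hj⟩ := exists_conj_etaMultiplier_eq_addExp γ
  obtain ⟨j₀, hj₀⟩ := exists_conj_etaMultiplier_eq_addExp γ₀
  have hq : 24 * c ≠ 0 := by omega
  set m : ℤ := (c : ℤ) * (-6 + j + j₀) + γ 0 0 * w ^ 2 + γ₀ 0 0 with hm
  let P : ℤ[X] := cuspGaussPoly c (γ 1 1) w * cuspGaussPoly c (γ₀ 1 1) 1 -
    C (12 * c * kroneckerTwelve w) * X ^ (m % (24 * c : ℕ)).toNat
  have hval (l : ℕ) : aeval (addExp (24 * c) 1 ^ l) P = cuspGaussSum c l (γ 1 1) w *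
      cuspGaussSum c l (γ₀ 1 1) 1 - 12 * c * kroneckerTwelve w * addExp (24 * c) (l * m) := by
    simp only [P]
    rw [map_sub, map_mul, map_mul, map_pow, aeval_X, aeval_C, addExp_pow_emod_toNat hq,
      aeval_cuspGaussPoly hc, aeval_cuspGaussPoly hc]
    simp
  have hexp (l : ℕ) (hl : (l : ℤ) ≡ 1 [ZMOD 24]) : addExp (24 * c) (l * m) =
      addExp 8 (-2) * addExp 24 j * addExp 24 j₀ * addExp (24 * c) (l * (γ 0 0 * w ^ 2)) *
        addExp (24 * c) (l * γ₀ 0 0) := by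
    have h8 : addExp 8 (-2) = addExp 24 (-6) := by
      have := addExp_mul_mul (k := 3) (by norm_num) 8 (-2)
      norm_num at this
      exact this.symm
    rw [h8, ← addExp_add, ← addExp_add, ← addExp_mul_mul hc.ne' 24, mul_comm c 24, ← addExp_add,
      ← addExp_add]
    refine addExp_congr ?_
    have h1 : (c : ℤ) * l * (-6 + j + j₀) ≡ c * 1 * (-6 + j + j₀) [ZMOD c * 24] := by
      rw [mul_assoc, mul_assoc]
      exact (hl.mul_right _).mul_left'
    push_cast
    rw [mul_comm (24 : ℤ)]
    have h2 := (h1.add_right (l * (γ 0 0 * w ^ 2))).add_right (l * γ₀ 0 0)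
    rw [mul_one] at h2
    convert! h2 using 1
    rw [hm]; ring
  have h1 : aeval (addExp (24 * c) 1) P = 0 := by
    have h := hval 1
    rw [pow_one] at h
    rw [h, Nat.cast_one, cuspGaussSum_one_eq hc hγ, cuspGaussSum_one_eq hc hγ₀, hj, hj₀]
    have he := hexp 1 rfl
    rw [Nat.cast_one] at he
    rw [he, show addExp 8 (-2) = addExp 8 (-1) * addExp 8 (-1) by rw [← addExp_add]; norm_num]
    have hs : ((√(12 * c) : ℝ) : ℂ) * ((√(12 * c) : ℝ) : ℂ) = 12 * c := by
      rw [← Complex.ofReal_mul, Real.mul_self_sqrt (by positivity)]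
      push_cast; ring
    have hk : (kroneckerTwelve 1 : ℂ) = 1 := by simp [kroneckerTwelve]
    rw [hk]
    simp only [one_pow, mul_one, one_mul]
    linear_combination (addExp 8 (-1) ^ 2 * addExp 24 j * addExp 24 j₀ * kroneckerTwelve w *
      addExp (24 * c) (γ 0 0 * w ^ 2) * addExp (24 * c) (γ₀ 0 0)) * hs
  have h2 := aeval_pow_eq_zero_of_aeval_eq_zero (by omega) (isPrimitiveRoot_addExp_one hq) hk h1
  rw [hval, hexp k hk1, sub_eq_zero] at h2
  rw [h2, hj, hj₀]
  ring

/-- The twisted Gauss sums at the cusps with denominator `c` compute the conjugate of the multiplier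
up to a constant of absolute value `√(12c)` that does not depend on the cusp. -/
theorem exists_cuspGaussSum_eq_mul_conj_etaMultiplier {c k : ℕ} (hc : 0 < c) (hk : k.Coprime (24 * c))
    (hk1 : (k : ℤ) ≡ 1 [ZMOD 24]) :
    ∃ κ : ℂ, ‖κ‖ = √(12 * c) ∧ ∀ γ : SL(2, ℤ), γ 1 0 = c → ∀ w : ℤ,
      cuspGaussSum c k (γ 1 1) w = κ * (starRingEnd ℂ) (etaMultiplier γ) * kroneckerTwelve w *
        addExp (24 * c) (k * (γ 0 0 * w ^ 2)) := by
  have hcR : (0 : ℝ) < c := by exact_mod_cast hc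
  by_cases h : ∃ γ₀ : SL(2, ℤ), γ₀ 1 0 = c
  · obtain ⟨γ₀, hγ₀⟩ := h
    set G := cuspGaussSum c k (γ₀ 1 1) 1
    have hn : ‖G‖ ^ 2 = 12 * c := by
      have h := congrArg norm (cuspGaussSum_mul_cuspGaussSum hc hk hk1 hγ₀ hγ₀ 1)
      simp only [norm_mul, norm_addExp, RCLike.norm_conj, norm_etaMultiplier] at h
      rw [pow_two, h]
      simp [kroneckerTwelve]
    have hG : ‖G‖ = √(12 * c) := by rw [← hn, Real.sqrt_sq (norm_nonneg _)]
    have hG0 : G ≠ 0 := by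
      rw [← norm_ne_zero_iff, hG]; exact (Real.sqrt_pos.mpr (by positivity)).ne'
    refine ⟨12 * c * addExp 8 (-2) * (starRingEnd ℂ) (etaMultiplier γ₀) * addExp (24 * c) (k * γ₀ 0 0) / G,
      ?_, fun γ hγ w => ?_⟩
    · simp only [norm_div, norm_mul, norm_addExp, RCLike.norm_conj, norm_etaMultiplier, hG]
      rw [div_eq_iff (Real.sqrt_pos.mpr (by positivity)).ne', Real.mul_self_sqrt (by positivity)]
      simp
    · have := cuspGaussSum_mul_cuspGaussSum hc hk hk1 hγ hγ₀ w
      rw [← mul_left_inj' hG0, this]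
      field_simp
  · refine ⟨√(12 * c), ?_, fun γ hγ => (h ⟨γ, hγ⟩).elim⟩
    rw [Complex.norm_real, Real.norm_eq_abs, abs_of_nonneg (Real.sqrt_nonneg _)]

/-! ### Counting square roots modulo `L` -/

theorem card_nsmul_eq_zero_le {q : ℕ} [NeZero q] {t : ℕ} (ht : 0 < t) :
    (Finset.univ.filter fun z : ZMod q => t • z = 0).card ≤ t :=
  IsAddCyclic.card_nsmul_eq_zero_le ht

/-- A residue class `y` with `y² = 1` modulo `L` is determined by the divisor `gcd(y - 1, L)` of `L` up to
`2`-torsion. -/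
theorem card_sq_eq_one_le (L : ℕ) [NeZero L] :
    (Finset.univ.filter fun y : ZMod L => y ^ 2 = 1).card ≤ 2 * L.divisors.card := by
  have hL : (L : ℤ) ≠ 0 := by exact_mod_cast NeZero.ne L
  let f : ZMod L → ℕ := fun y => Int.gcd ((y.val : ℤ) - 1) L
  have himg : (Finset.univ.filter fun y : ZMod L => y ^ 2 = 1).image f ⊆ L.divisors := by
    intro d hd
    obtain ⟨y, -, rfl⟩ := Finset.mem_image.mp hd
    rw [Nat.mem_divisors]
    exact ⟨by exact_mod_cast Int.gcd_dvd_right ((y.val : ℤ) - 1) (L : ℤ), NeZero.ne L⟩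
  refine (Finset.card_le_mul_card_image (f := f) _ 2 fun d hd => ?_).trans
    (Nat.mul_le_mul_left 2 (Finset.card_le_card himg))
  obtain ⟨y₀, hy₀, rfl⟩ := Finset.mem_image.mp hd
  -- With `d = gcd(y - 1, L)` one has `d ∣ y - 1` and `L / d ∣ y + 1`.
  have key (y : ZMod L) (hy : y ^ 2 = 1) : ∃ e : ℤ, (L : ℤ) = f y * e ∧ (f y : ℤ) ∣ y.val - 1 ∧
      e ∣ y.val + 1 := by
    have hpos : 0 < Int.gcd ((y.val : ℤ) - 1) L := Int.gcd_pos_of_ne_zero_right _ hL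
    obtain ⟨a, e, hcop, ha, he⟩ := Int.exists_gcd_one hpos
    refine ⟨e, by rw [mul_comm]; exact he, Int.gcd_dvd_left _ _, ?_⟩
    have h1 : (L : ℤ) ∣ ((y.val : ℤ) - 1) * (y.val + 1) := by
      rw [← ZMod.intCast_zmod_eq_zero_iff_dvd]
      push_cast
      rw [ZMod.natCast_zmod_val]
      linear_combination hy
    have h2 : e * (f y : ℤ) ∣ (a * (y.val + 1)) * f y := by
      refine (dvd_of_eq he.symm).trans (h1.trans (dvd_of_eq ?_))
      rw [ha]; ring
    have h3 := Int.dvd_of_mul_dvd_mul_right (by exact_mod_cast hpos.ne') h2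
    exact Int.dvd_of_dvd_mul_right_of_gcd_one h3 (by rw [Int.gcd_comm]; exact hcop)
  rw [Finset.mem_filter] at hy₀
  obtain ⟨e, he, hd₀, he₀⟩ := key y₀ hy₀.2
  refine le_trans (Finset.card_le_card_of_injOn (fun y => y - y₀) ?_
    (fun a _ b _ h => sub_left_injective h)) (card_nsmul_eq_zero_le (q := L) two_pos)
  intro y hy
  rw [Finset.mem_coe, Finset.mem_filter, Finset.mem_filter] at hy
  obtain ⟨⟨-, hy1⟩, hfy⟩ := hy
  obtain ⟨e', he', hd', he''⟩ := key y hy1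
  rw [hfy] at he' hd'
  have hd0 : (f y₀ : ℤ) ≠ 0 := fun h => hL (by rw [he, h, zero_mul])
  obtain rfl : e' = e := mul_left_cancel₀ hd0 (he'.symm.trans he)
  rw [Finset.mem_coe, Finset.mem_filter]
  refine ⟨Finset.mem_univ _, ?_⟩
  have h1 : (f y₀ : ℤ) ∣ (y.val : ℤ) - y₀.val := by
    have := dvd_sub hd' hd₀
    rwa [sub_sub_sub_cancel_right] at this
  have h2 : e' ∣ (y.val : ℤ) - y₀.val := by
    have := dvd_sub he'' he₀
    rwa [add_sub_add_right_eq_sub] at this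
  have h3 : (L : ℤ) ∣ 2 * ((y.val : ℤ) - y₀.val) := by
    have h4 := mul_dvd_mul h1 he₀
    have h5 := mul_dvd_mul hd₀ h2
    rw [← he] at h4 h5
    exact (dvd_sub h4 h5).trans (dvd_of_eq (by ring))
  rw [← ZMod.intCast_zmod_eq_zero_iff_dvd] at h3
  push_cast at h3
  rw [ZMod.natCast_zmod_val, ZMod.natCast_zmod_val] at h3
  rw [nsmul_eq_mul]
  exact_mod_cast h3

/-- A set of residues modulo `q` that is mapped to square roots of `1` modulo `r`, with fibres of
elements differing by `t`-torsion. -/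
theorem card_le_of_sq_eq_one {q r t : ℕ} [NeZero q] [NeZero r] (ht : 0 < t) (S : Finset (ZMod q))
    (f : ZMod q → ZMod r) (hf : ∀ x ∈ S, f x ^ 2 = 1)
    (hinj : ∀ x ∈ S, ∀ y ∈ S, f x = f y → t • (x - y) = 0) :
    S.card ≤ t * (2 * r.divisors.card) := by
  have himg : S.image f ⊆ Finset.univ.filter fun y : ZMod r => y ^ 2 = 1 := by
    intro y hy
    obtain ⟨x, hx, rfl⟩ := Finset.mem_image.mp hy
    simp [hf x hx]
  refine (Finset.card_le_mul_card_image (f := f) S t fun d hd => ?_).trans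
    (Nat.mul_le_mul_left t ((Finset.card_le_card himg).trans (card_sq_eq_one_le r)))
  obtain ⟨x₀, hx₀, rfl⟩ := Finset.mem_image.mp hd
  refine le_trans (Finset.card_le_card_of_injOn (fun y => y - x₀) ?_
    (fun a _ b _ h => sub_left_injective h)) (card_nsmul_eq_zero_le (q := q) ht)
  intro y hy
  rw [Finset.mem_coe, Finset.mem_filter] at hy
  rw [Finset.mem_coe, Finset.mem_filter]
  exact ⟨Finset.mem_univ _, hinj y hy.1 x₀ hx₀ hy.2⟩

theorem isUnit_intCast_zmod_iff {q : ℕ} {a : ℤ} : IsUnit (a : ZMod q) ↔ IsCoprime a q := by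
  constructor
  · rintro ⟨u, hu⟩
    obtain ⟨b, hb⟩ := ZMod.intCast_surjective ((u⁻¹ : (ZMod q)ˣ) : ZMod q)
    have h : ((a * b : ℤ) : ZMod q) = (1 : ℤ) := by
      push_cast; rw [hb, ← hu, Units.mul_inv]
    rw [ZMod.intCast_eq_intCast_iff] at h
    obtain ⟨t, ht⟩ := h.dvd
    exact ⟨b, t, by linarith⟩
  · rintro ⟨u, v, h⟩
    refine IsUnit.of_mul_eq_one (u : ZMod q) ?_
    have := congrArg (fun x : ℤ => (x : ZMod q)) h
    push_cast at this
    rw [ZMod.natCast_self, mul_zero, add_zero] at this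
    rw [mul_comm]; exact this

/-- The number of square roots of `D` modulo `L`. With `(D, L) = a b²` and `a` squarefree, dividing a root
by `a b` leads to square roots of a unit modulo `L / (a b²)`, and costs a factor `b ≤ √(D, L)`. -/
theorem card_sq_eq_le (L : ℕ) [NeZero L] (D : ℤ) :
    ((Finset.univ.filter fun x : ZMod L => x ^ 2 = (D : ZMod L)).card : ℝ) ≤
      2 * L.divisors.card * √(Int.gcd D L) := by
  have hL : (L : ℤ) ≠ 0 := by exact_mod_cast NeZero.ne L
  have hpos : 0 < Int.gcd D L := Int.gcd_pos_of_ne_zero_right _ hL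
  obtain ⟨D', L', hcop, hD, hL'⟩ := Int.exists_gcd_one hpos
  obtain ⟨a, b, hg, hsq⟩ := Nat.sq_mul_squarefree (Int.gcd D L)
  rw [← hg] at hD hL' hpos ⊢
  have ha : 0 < a := Nat.pos_of_ne_zero fun h => by simp [h] at hpos
  have hb : 0 < b := Nat.pos_of_ne_zero fun h => by simp [h] at hpos
  obtain ⟨r, rfl⟩ : ∃ r : ℕ, L' = r := by
    refine ⟨L'.toNat, (Int.toNat_of_nonneg ?_).symm⟩
    have h1 : (0 : ℤ) < ((b ^ 2 * a : ℕ) : ℤ) := by exact_mod_cast hpos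
    nlinarith [Int.natCast_nonneg L]
  have hr : r ≠ 0 := fun h => hL (by rw [hL', h]; simp)
  have : NeZero r := ⟨hr⟩
  have hLr : L = r * (b ^ 2 * a) := by exact_mod_cast hL'
  have hrdvd : r ∣ L := ⟨_, hLr⟩
  have hcop' : IsCoprime D' (r : ℤ) := Int.isCoprime_iff_gcd_eq_one.mpr hcop
  set S := Finset.univ.filter fun x : ZMod L => x ^ 2 = (D : ZMod L) with hS
  -- Every root is `a b y` with `a y² ≡ D / (a b²)` modulo `L / (a b²)`.
  have hmem (x : ZMod L) (hx : x ∈ S) : ∃ y : ℤ, (x.val : ℤ) = a * b * y ∧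
      (a : ZMod r) * (y : ZMod r) ^ 2 = D' := by
    have hx2 : (L : ℤ) ∣ (x.val : ℤ) ^ 2 - D := by
      rw [← ZMod.intCast_zmod_eq_zero_iff_dvd]
      push_cast
      rw [ZMod.natCast_zmod_val, sub_eq_zero]
      exact (Finset.mem_filter.mp hx).2
    have hgd : ((b ^ 2 * a : ℕ) : ℤ) ∣ (x.val : ℤ) ^ 2 := by
      have h1 : ((b ^ 2 * a : ℕ) : ℤ) ∣ D := ⟨D', by rw [hD]; ring⟩
      have h2 : ((b ^ 2 * a : ℕ) : ℤ) ∣ L := ⟨r, by rw [hL']; ring⟩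
      simpa using dvd_add (h2.trans hx2) h1
    have hgd' : b ^ 2 * a ∣ x.val ^ 2 := by exact_mod_cast hgd
    obtain ⟨x', hx'⟩ : b ∣ x.val := (Nat.pow_dvd_pow_iff two_ne_zero).mp ((dvd_mul_right _ _).trans hgd')
    rw [hx', mul_pow] at hgd'
    have h3 := Nat.dvd_of_mul_dvd_mul_left (by positivity) hgd'
    obtain ⟨y, hy⟩ : a ∣ x' := (hsq.dvd_pow_iff_dvd two_ne_zero).mp h3
    refine ⟨y, by rw [hx', hy]; push_cast; ring, ?_⟩
    have h4 : (r : ℤ) ∣ a * (y : ℤ) ^ 2 - D' := by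
      have h5 : ((b ^ 2 * a : ℕ) : ℤ) * r ∣ ((b ^ 2 * a : ℕ) : ℤ) * (a * (y : ℤ) ^ 2 - D') := by
        refine (dvd_of_eq ?_).trans (hx2.trans (dvd_of_eq ?_))
        · rw [hL']; ring
        · rw [hD, hx', hy]; push_cast; ring
      exact Int.dvd_of_mul_dvd_mul_left (by exact_mod_cast hpos.ne') h5
    rw [← ZMod.intCast_zmod_eq_zero_iff_dvd] at h4
    push_cast at h4 ⊢
    exact sub_eq_zero.mp h4
  have hunit : IsUnit (D' : ZMod r) := isUnit_intCast_zmod_iff.mpr hcop'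
  have hcard : S.card ≤ b * (2 * r.divisors.card) := by
    rcases S.eq_empty_or_nonempty with h0 | ⟨x₀, hx₀⟩
    · rw [h0]; simp
    choose! Y hY1 hY2 using hmem
    have haU : IsUnit (a : ZMod r) := isUnit_of_mul_isUnit_left ((hY2 x₀ hx₀) ▸ hunit)
    have hyU : IsUnit ((Y x₀ : ℤ) : ZMod r) := by
      have h := isUnit_of_mul_isUnit_right ((hY2 x₀ hx₀) ▸ hunit)
      exact (isUnit_pow_iff two_ne_zero).mp h
    obtain ⟨v, hv⟩ := hyU
    refine card_le_of_sq_eq_one (r := r) hb S (fun x => (Y x : ZMod r) * (v⁻¹ : (ZMod r)ˣ)) ?_ ?_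
    · intro x hx
      have h1 : (Y x : ZMod r) ^ 2 = v ^ 2 := by
        rw [hv]
        exact haU.mul_left_cancel ((hY2 x hx).trans (hY2 x₀ hx₀).symm)
      rw [mul_pow, h1, ← mul_pow, Units.mul_inv, one_pow]
    · intro x hx y hy hxy
      have h1 : (Y x : ZMod r) = Y y := (Units.mul_left_inj v⁻¹).mp hxy
      rw [ZMod.intCast_eq_intCast_iff] at h1
      obtain ⟨t, ht⟩ := h1.symm.dvd
      have h2 : (L : ℤ) ∣ b * ((x.val : ℤ) - y.val) := by
        refine ⟨t, ?_⟩
        rw [hY1 x hx, hY1 y hy, hL']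
        push_cast
        linear_combination (a * b ^ 2 : ℤ) * ht
      rw [← ZMod.intCast_zmod_eq_zero_iff_dvd] at h2
      push_cast at h2
      rw [ZMod.natCast_zmod_val, ZMod.natCast_zmod_val] at h2
      rw [nsmul_eq_mul]
      exact h2
  have hdiv : (r.divisors.card : ℝ) ≤ L.divisors.card := by
    exact_mod_cast Finset.card_le_card (Nat.divisors_subset_of_dvd (NeZero.ne L) hrdvd)
  have hbs : (b : ℝ) ≤ √((b ^ 2 * a : ℕ) : ℝ) := by
    refine Real.le_sqrt_of_sq_le ?_
    exact_mod_cast Nat.le_mul_of_pos_right _ ha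
  calc (S.card : ℝ) ≤ b * (2 * r.divisors.card) := by exact_mod_cast hcard
    _ ≤ √((b ^ 2 * a : ℕ) : ℝ) * (2 * L.divisors.card) :=
        mul_le_mul hbs (by linarith) (mul_nonneg two_pos.le (Nat.cast_nonneg _)) (Real.sqrt_nonneg _)
    _ = _ := by ring

/-- Solutions in units of a quadratic congruence `k u² ≡ l` modulo a divisor `r` of `q`. -/
theorem card_units_quadratic_le {q r : ℕ} [NeZero q] [NeZero r] (hrq : r ∣ q) {k l : ℤ}
    (hcop : ∃ α β ρ : ℤ, α * k + β * l + ρ * r = 1) (S : Finset (ZMod q)ˣ)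
    (hS : ∀ u ∈ S, (k : ZMod r) * (ZMod.castHom hrq (ZMod r) u) ^ 2 = l) :
    S.card ≤ q / r * (2 * r.divisors.card) := by
  rcases S.eq_empty_or_nonempty with rfl | ⟨u₀, hu₀⟩
  · simp
  set φ := ZMod.castHom hrq (ZMod r)
  obtain ⟨α, β, ρ, h⟩ := hcop
  have hk : IsUnit (k : ZMod r) := by
    have h1 := congrArg (fun x : ℤ => (x : ZMod r)) h
    push_cast at h1
    rw [ZMod.natCast_self, mul_zero, add_zero] at h1
    refine IsUnit.of_mul_eq_one ((α : ZMod r) + β * (φ u₀) ^ 2) ?_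
    rw [← h1]
    linear_combination β * hS u₀ hu₀
  have hqr : 0 < q / r := Nat.div_pos (Nat.le_of_dvd (NeZero.pos q) hrq) (NeZero.pos r)
  rw [← Finset.card_map ⟨fun u : (ZMod q)ˣ => (u : ZMod q), Units.val_injective⟩]
  refine card_le_of_sq_eq_one (r := r) hqr _ (fun x => φ (x * (u₀⁻¹ : (ZMod q)ˣ))) ?_ ?_
  · intro x hx
    obtain ⟨u, hu, rfl⟩ := Finset.mem_map.mp hx
    have h1 : φ u ^ 2 = φ u₀ ^ 2 := hk.mul_left_cancel ((hS u hu).trans (hS u₀ hu₀).symm)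
    simp only [Function.Embedding.coeFn_mk]
    rw [map_mul, mul_pow, h1, ← mul_pow, ← map_mul, Units.mul_inv, map_one, one_pow]
  · intro x _ y _ hxy
    have h1 : φ (x - y) = 0 := by
      have h2 : φ ((x - y) * (u₀⁻¹ : (ZMod q)ˣ)) = 0 := by
        rw [sub_mul, map_sub, sub_eq_zero]; exact hxy
      calc φ (x - y) = φ ((x - y) * (u₀⁻¹ : (ZMod q)ˣ) * u₀) := by
            rw [mul_assoc, Units.inv_mul, mul_one]
        _ = 0 := by rw [map_mul, h2, zero_mul]
    obtain ⟨t, ht⟩ := hrq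
    set z := x - y
    have h2 : r ∣ z.val := by
      rw [← ZMod.natCast_eq_zero_iff, ← h1]
      simp [φ]
    have hz : z = ((z.val : ℕ) : ZMod q) := (ZMod.natCast_zmod_val z).symm
    have hq : q / r = t := by rw [ht, Nat.mul_div_cancel_left _ (NeZero.pos r)]
    rw [hq, hz, nsmul_eq_mul, ← Nat.cast_mul, ZMod.natCast_eq_zero_iff]
    obtain ⟨w, hw⟩ := h2
    exact ⟨w, by rw [hw, ht]; ring⟩

/-- The part `B` of `q` prime to `m`, and its cofactor `A`, all of whose prime factors divide `m`. -/
theorem exists_mul_coprime_of_ne_zero (m : ℕ) {q : ℕ} (hq : q ≠ 0) :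
    ∃ A B : ℕ, q = A * B ∧ B.Coprime m ∧ A.Coprime B ∧ ∀ p : ℕ, p.Prime → p ∣ A → p ∣ m := by
  suffices h : ∃ A B : ℕ, q = A * B ∧ B.Coprime m ∧ ∀ p : ℕ, p.Prime → p ∣ A → p ∣ m by
    obtain ⟨A, B, h1, h2, h3⟩ := h
    refine ⟨A, B, h1, h2, Nat.coprime_of_dvd fun p hp hA hB => ?_, h3⟩
    exact hp.one_lt.ne' (Nat.dvd_one.mp (h2 ▸ Nat.dvd_gcd hB (h3 p hp hA)))
  induction q using Nat.strong_induction_on with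
  | _ q ih =>
  by_cases hcop : q.Coprime m
  · exact ⟨1, q, (one_mul q).symm, hcop, fun p hp h => absurd (Nat.dvd_one.mp h) hp.one_lt.ne'⟩
  · obtain ⟨q', hq'⟩ := Nat.gcd_dvd_left q m
    have hd0 : 0 < Nat.gcd q m := Nat.gcd_pos_of_pos_left _ (Nat.pos_of_ne_zero hq)
    have hd : 1 < Nat.gcd q m := lt_of_le_of_ne hd0 (Ne.symm hcop)
    have hq0 : 0 < q' := Nat.pos_of_ne_zero fun h => hq (by rw [hq', h, mul_zero])
    obtain ⟨A, B, h1, h2, h3⟩ := ih q' (by rw [hq']; exact lt_mul_of_one_lt_left hq0 hd) hq0.ne'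
    refine ⟨Nat.gcd q m * A, B, by rw [mul_assoc, ← h1]; exact hq', h2, fun p hp h => ?_⟩
    rcases hp.dvd_mul.mp h with h | h
    · exact h.trans (Nat.gcd_dvd_right q m)
    · exact h3 p hp h

/-! ### Salié-type sums -/

theorem norm_stdAddChar {q : ℕ} [NeZero q] (a : ZMod q) : ‖ZMod.stdAddChar a‖ = 1 := by
  rw [ZMod.stdAddChar_apply]; exact Circle.norm_coe _

theorem conj_stdAddChar {q : ℕ} [NeZero q] (a : ZMod q) :
    (starRingEnd ℂ) (ZMod.stdAddChar a) = ZMod.stdAddChar (-a) := by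
  rw [AddChar.map_neg_eq_inv, Complex.inv_eq_conj (norm_stdAddChar a)]

/-- The quadratic Gauss sum to an odd modulus has absolute value `√q`. -/
theorem norm_quadratic_gaussSum {q : ℕ} [NeZero q] (hq : IsUnit (2 : ZMod q)) {b : ZMod q}
    (hb : IsUnit b) : ‖∑ z : ZMod q, ZMod.stdAddChar (b * z ^ 2)‖ = √q := by
  set G := ∑ z : ZMod q, ZMod.stdAddChar (b * z ^ 2)
  have h : (G * (starRingEnd ℂ) G) = q := by
    have h1 : G * (starRingEnd ℂ) G = ∑ z : ZMod q, ∑ h : ZMod q,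
        ZMod.stdAddChar (b * h ^ 2) * ZMod.stdAddChar (z * (2 * b * h)) := by
      rw [mul_comm, map_sum, Finset.sum_mul]
      refine Finset.sum_congr rfl fun z _ => ?_
      rw [Finset.mul_sum, ← Equiv.sum_comp (Equiv.addRight z)]
      refine Finset.sum_congr rfl fun h _ => ?_
      rw [conj_stdAddChar, ← AddChar.map_add_eq_mul, ← AddChar.map_add_eq_mul]
      congr 1
      simp only [Equiv.coe_addRight]
      ring
    rw [h1, Finset.sum_comm]
    simp_rw [← Finset.mul_sum, AddChar.sum_mulShift _ (ZMod.isPrimitive_stdAddChar q)]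
    rw [Finset.sum_eq_single 0]
    · simp
    · intro h _ hh
      rw [if_neg, Nat.cast_zero, mul_zero]
      intro h0
      exact hh ((hq.mul hb).mul_right_eq_zero.mp h0)
    · simp
  rw [Complex.mul_conj, Complex.normSq_eq_norm_sq] at h
  have h' : ‖G‖ ^ 2 = q := by exact_mod_cast h
  rw [← h', Real.sqrt_sq (norm_nonneg _)]

/-- If translation by `h` multiplies the summand `F` by an invariant factor `ω`, then only the terms with
`ω = 1` contribute to the sum. -/
theorem sum_eq_sum_filter_of_quasi_invariant {G : Type*} [Group G] [Fintype G] [DecidableEq ℂ] (F ω : G → ℂ)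
    (h : G) (hF : ∀ u, F (u * h) = F u * ω u) (hω : ∀ u, ω (u * h) = ω u) :
    ∑ u, F u = ∑ u ∈ Finset.univ.filter (fun u => ω u = 1), F u := by
  let E : G → ℂ := fun u => if ω u = 1 then 0 else F u / (1 - ω u)
  have h1 : ∑ u, (E u - E (u * h)) = 0 := by
    rw [Finset.sum_sub_distrib, sub_eq_zero]
    exact (Equiv.sum_comp (Equiv.mulRight h) E).symm
  rw [Finset.sum_filter, ← sub_eq_zero, ← Finset.sum_sub_distrib]
  refine (Finset.sum_congr rfl fun u _ => ?_).trans h1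
  simp only [E, hω, hF]
  split_ifs with hu
  · simp
  · have : 1 - ω u ≠ 0 := sub_ne_zero.mpr (Ne.symm hu)
    field_simp
    ring

/-- The Salié-type sum `∑_{u ∈ (ℤ/q)ˣ} (∑_{z mod q} e(b z² u / q)) e((l u⁻¹ + k u) / q)`. -/
noncomputable def salieSum (q : ℕ) [NeZero q] (b l k : ZMod q) : ℂ :=
  ∑ u : (ZMod q)ˣ, (∑ z : ZMod q, ZMod.stdAddChar (N := q) (b * z ^ 2 * u)) *
    ZMod.stdAddChar (l * ((u⁻¹ : (ZMod q)ˣ) : ZMod q) + (k : ZMod q) * (u : ZMod q))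

/-- Bound for Salié-type sums by stationary phase: with `g = gcd(l, k, q)` and `q / g = r₁ r₂²`, the
substitution `u ↦ u (1 + s)²` for a suitable `s` divisible by `r₁ r₂` and by all primes dividing `q`
confines the sum to those `u` with `(k / g) u² ≡ l / g` modulo `r₂`. -/
theorem exists_norm_salieSum_le {q : ℕ} [NeZero q] (hq : IsUnit (2 : ZMod q)) {b : ZMod q} (hb : IsUnit b)
    (l k : ℤ) : ∃ r₁ : ℕ, Squarefree r₁ ∧ Int.gcd (Int.gcd l k) q * r₁ ∣ q ∧
      ‖salieSum q b l k‖ ≤ 2 * q.divisors.card * q * √(Int.gcd (Int.gcd l k) q * r₁) := by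
  classical
  have hq0 : (q : ℤ) ≠ 0 := by exact_mod_cast NeZero.ne q
  set g := Int.gcd (Int.gcd l k) q
  have hg0 : 0 < g := Int.gcd_pos_of_ne_zero_right _ hq0
  have hgq : g ∣ q := by
    have := Int.gcd_dvd_right ((Int.gcd l k : ℕ) : ℤ) (q : ℤ)
    exact_mod_cast this
  have hglk : (g : ℤ) ∣ (Int.gcd l k : ℕ) := Int.gcd_dvd_left _ _
  obtain ⟨l', hl'⟩ : (g : ℤ) ∣ l := hglk.trans (Int.gcd_dvd_left _ _)
  obtain ⟨k', hk'⟩ : (g : ℤ) ∣ k := hglk.trans (Int.gcd_dvd_right _ _)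
  obtain ⟨r, hr⟩ := hgq
  have hr0 : r ≠ 0 := fun h => NeZero.ne q (by rw [hr, h, mul_zero])
  obtain ⟨r₁, r₂, hr12, hsq⟩ := Nat.sq_mul_squarefree r
  have hr10 : 0 < r₁ := Nat.pos_of_ne_zero hsq.ne_zero
  have hr20 : 0 < r₂ := Nat.pos_of_ne_zero fun h => hr0 (by rw [← hr12, h]; simp)
  have : NeZero r₂ := ⟨hr20.ne'⟩
  have hqeq : q = g * (r₂ ^ 2 * r₁) := by rw [hr12]; exact hr
  have hr2q : r₂ ∣ q := ⟨g * r₂ * r₁, by rw [hqeq]; ring⟩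
  refine ⟨r₁, hsq, ⟨r₂ ^ 2, by rw [hqeq]; ring⟩, ?_⟩
  obtain ⟨A, B, hAB, hBr, -, hA⟩ := exists_mul_coprime_of_ne_zero r (NeZero.ne q)
  -- `B` is prime to `r`, so it makes `s` divisible by the primes not dividing `r` without restricting
  -- the congruence modulo `r₂` obtained below.
  set s : ℕ := r₁ * r₂ * B with hs
  -- `1 + s` is a unit modulo `q`, because every prime dividing `q` divides `s`.
  have hcop : (1 + s).Coprime q := by
    refine Nat.coprime_of_dvd fun p hp h1 h2 => ?_
    have h3 : p ∣ s := by
      rw [hAB] at h2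
      rcases hp.dvd_mul.mp h2 with h | h
      · have h4 := hA p hp h
        rw [← hr12] at h4
        refine (Dvd.dvd.mul_right ?_ B)
        rcases hp.dvd_mul.mp h4 with h5 | h5
        · exact (hp.dvd_of_dvd_pow h5).mul_left _
        · exact h5.mul_right _
      · exact h.mul_left _
    exact hp.one_lt.ne' (Nat.dvd_one.mp ((Nat.dvd_add_iff_left h3).mpr h1))
  set h : (ZMod q)ˣ := ZMod.unitOfCoprime (1 + s) hcop
  have hh : (h : ZMod q) = 1 + s := by simp [h]
  have hgs : (g : ZMod q) * (s : ZMod q) ^ 2 = 0 := by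
    have : ((g * s ^ 2 : ℕ) : ZMod q) = 0 := by
      rw [ZMod.natCast_eq_zero_iff]
      exact ⟨r₁ * B ^ 2, by rw [hs, hqeq]; ring⟩
    exact_mod_cast this
  have hks : (k : ZMod q) * (s : ZMod q) ^ 2 = 0 := by
    rw [hk']; push_cast; linear_combination (k' : ZMod q) * hgs
  have hls : (l : ZMod q) * (s : ZMod q) ^ 2 = 0 := by
    rw [hl']; push_cast; linear_combination (l' : ZMod q) * hgs
  have hinv : ((h⁻¹ : (ZMod q)ˣ) : ZMod q) * (1 + s) = 1 := by rw [← hh, Units.inv_mul]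
  set i : ZMod q := ((h⁻¹ : (ZMod q)ˣ) : ZMod q)
  -- As `l s² = k s² = 0`, one has `l (1 + s)⁻² = l (1 - 2 s)`, and likewise `k (1 + s)² = k (1 + 2 s)`: the
  -- phase varies linearly.
  have hlsi : (l : ZMod q) * s * i = l * s := by
    linear_combination (l : ZMod q) * s * hinv - i * hls
  have hli : (l : ZMod q) * i ^ 2 = l - 2 * l * s := by
    linear_combination (l : ZMod q) * i * hinv - i * hlsi - 2 * hlsi + l * hinv
  let g' : (ZMod q)ˣ → ℂ := fun u => ∑ z : ZMod q, ZMod.stdAddChar (N := q) (b * z ^ 2 * u)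
  let ω : (ZMod q)ˣ → ℂ := fun u => ZMod.stdAddChar
    (2 * (s : ZMod q) * ((k : ZMod q) * (u : ZMod q) - (l : ZMod q) * ((u⁻¹ : (ZMod q)ˣ) : ZMod q)))
  have hF := sum_eq_sum_filter_of_quasi_invariant
    (fun u : (ZMod q)ˣ => g' u * ZMod.stdAddChar ((l : ZMod q) * ((u⁻¹ : (ZMod q)ˣ) : ZMod q) + (k : ZMod q) * (u : ZMod q))) ω (h ^ 2)
    (fun u => by
      -- The inner sum depends only on `u` up to squares, by the substitution `z ↦ h z`.
      have h1 : g' (u * h ^ 2) = g' u := by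
        simp only [g']
        rw [← Equiv.sum_comp (Units.mulLeft h) (fun z => ZMod.stdAddChar (N := q) (b * z ^ 2 * u))]
        refine Finset.sum_congr rfl fun z _ => ?_
        congr 1
        simp only [Units.mulLeft_apply]
        push_cast
        ring
      rw [h1, mul_assoc, ← AddChar.map_add_eq_mul]
      congr 2
      rw [mul_inv, Units.val_mul, Units.val_mul, ← inv_pow, Units.val_pow_eq_pow_val,
        Units.val_pow_eq_pow_val, hh]
      linear_combination ((u⁻¹ : (ZMod q)ˣ) : ZMod q) * hli + (u : ZMod q) * hks)
    (fun u => by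
      simp only [ω]
      congr 1
      rw [mul_inv, Units.val_mul, Units.val_mul, ← inv_pow, Units.val_pow_eq_pow_val,
        Units.val_pow_eq_pow_val, hh]
      linear_combination 2 * (u : ZMod q) * (2 + s) * hks -
        2 * s * ((u⁻¹ : (ZMod q)ˣ) : ZMod q) * hli + 4 * ((u⁻¹ : (ZMod q)ˣ) : ZMod q) * hls)
  set S := Finset.univ.filter (fun u => ω u = 1)
  have hg' (u : (ZMod q)ˣ) : ‖g' u‖ = √q := by
    simp only [g']
    rw [← norm_quadratic_gaussSum hq (hb.mul u.isUnit)]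
    congr 1
    refine Finset.sum_congr rfl fun z _ => ?_
    congr 1; ring
  have hsalie : ‖salieSum q b l k‖ ≤ S.card * √q := by
    rw [show salieSum q b l k = ∑ u : (ZMod q)ˣ, g' u * ZMod.stdAddChar
      ((l : ZMod q) * ((u⁻¹ : (ZMod q)ˣ) : ZMod q) + (k : ZMod q) * (u : ZMod q)) from rfl, hF]
    refine (norm_sum_le_of_le S (n := fun _ => √(q : ℝ)) fun u _ => ?_).trans (by simp)
    rw [norm_mul, hg', norm_stdAddChar, mul_one]
  -- The terms that survive satisfy `s (k u² - l) = 0` modulo `q`, that is `(k / g) u² ≡ l / g` modulo `r₂`.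
  have hcard : S.card ≤ q / r₂ * (2 * r₂.divisors.card) := by
    refine card_units_quadratic_le hr2q (k := k') (l := l') ?_ S fun u hu => ?_
    · -- `gcd(l / g, k / g, q / g) = 1`
      have h1 : (g : ℤ) = (Int.gcd l k : ℕ) * Int.gcdA (Int.gcd l k : ℕ) q + q * Int.gcdB (Int.gcd l k : ℕ) q :=
        Int.gcd_eq_gcd_ab _ _
      have h2 := Int.gcd_eq_gcd_ab l k
      set x := Int.gcdA (Int.gcd l k : ℕ) q
      set y := Int.gcdB (Int.gcd l k : ℕ) q
      set x' := Int.gcdA l k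
      set y' := Int.gcdB l k
      have hqZ : (q : ℤ) = g * (r₂ ^ 2 * r₁) := by exact_mod_cast hqeq
      refine ⟨y' * x, x' * x, r₂ * r₁ * y, mul_left_cancel₀ (show (g : ℤ) ≠ 0 by exact_mod_cast hg0.ne') ?_⟩
      rw [mul_one]
      conv_rhs => rw [h1, h2]
      linear_combination (-y' * x) * hk' - (x' * x) * hl' - y * hqZ
    · have h1 : ω u = 1 := (Finset.mem_filter.mp hu).2
      simp only [ω] at h1
      rw [← (ZMod.stdAddChar (N := q)).map_zero_eq_one, ZMod.injective_stdAddChar.eq_iff, mul_assoc] at h1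
      have h2 := hq.mul_right_eq_zero.mp h1
      have h3 : (s : ZMod q) * (k * (u : ZMod q) ^ 2 - l) = 0 := by
        have h4 := Units.mul_inv u
        linear_combination (u : ZMod q) * h2 + s * l * h4
      set a := (u : ZMod q).val with ha
      have hua : (u : ZMod q) = (a : ZMod q) := (ZMod.natCast_zmod_val _).symm
      have h5 : (q : ℤ) ∣ s * (k * (a : ℤ) ^ 2 - l) := by
        rw [← ZMod.intCast_zmod_eq_zero_iff_dvd]
        push_cast
        rw [← hua]
        exact h3
      have h6 : ((g * r₂ * r₁ : ℕ) : ℤ) * r₂ ∣ ((g * r₂ * r₁ : ℕ) : ℤ) * (B * (k' * (a : ℤ) ^ 2 - l')) := by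
        refine (dvd_of_eq ?_).trans (h5.trans (dvd_of_eq ?_))
        · rw [hqeq]; push_cast; ring
        · rw [hk', hl', hs]; push_cast; ring
      have h7 := Int.dvd_of_mul_dvd_mul_left (by
        have : 0 < g * r₂ * r₁ := by positivity
        exact_mod_cast this.ne') h6
      have hBr2 : IsCoprime (r₂ : ℤ) B := by
        rw [Nat.isCoprime_iff_coprime]
        rw [← hr12] at hBr
        exact (Nat.Coprime.coprime_dvd_right ((dvd_pow_self r₂ two_ne_zero).mul_right r₁) hBr).symm
      have h8 := hBr2.dvd_of_dvd_mul_left h7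
      rw [← ZMod.intCast_zmod_eq_zero_iff_dvd] at h8
      push_cast at h8
      rw [hua, map_natCast]
      exact sub_eq_zero.mp h8
  have hdiv : (r₂.divisors.card : ℝ) ≤ q.divisors.card := by
    exact_mod_cast Finset.card_le_card (Nat.divisors_subset_of_dvd (NeZero.ne q) hr2q)
  have hqr : q / r₂ = g * r₂ * r₁ := by
    rw [hqeq, show g * (r₂ ^ 2 * r₁) = r₂ * (g * r₂ * r₁) by ring, Nat.mul_div_cancel_left _ hr20]
  have hmain : ((g * r₂ * r₁ : ℕ) : ℝ) * √q = q * √(g * r₁) := by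
    have h1 : √(q : ℝ) = r₂ * √(g * r₁) := by
      rw [hqeq]
      push_cast
      rw [show (g : ℝ) * (r₂ ^ 2 * r₁) = r₂ ^ 2 * (g * r₁) by ring,
        Real.sqrt_mul (by positivity), Real.sqrt_sq (by positivity)]
    rw [h1]
    conv_rhs => rw [hqeq]
    push_cast
    ring
  calc ‖salieSum q b l k‖ ≤ S.card * √q := hsalie
    _ ≤ ((g * r₂ * r₁ : ℕ) * (2 * r₂.divisors.card) : ℝ) * √q := by
        gcongr
        rw [hqr] at hcard
        exact_mod_cast hcard
    _ = (2 * r₂.divisors.card) * (((g * r₂ * r₁ : ℕ) : ℝ) * √q) := by ring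
    _ ≤ (2 * q.divisors.card) * (((g * r₂ * r₁ : ℕ) : ℝ) * √q) := by gcongr
    _ = _ := by rw [hmain]; ring

/-! ### Ramanujan sums over the modulus prime to `M` -/

theorem sum_range_mul {α : Type*} [AddCommMonoid α] (a b : ℕ) (f : ℕ → α) :
    ∑ y ∈ Finset.range (a * b), f y = ∑ y ∈ Finset.range a, ∑ j ∈ Finset.range b, f (y + a * j) := by
  rw [Finset.sum_comm]
  induction b with
  | zero => simp
  | succ b ih =>
    rw [mul_add, mul_one, Finset.sum_range_add, ih, Finset.sum_range_succ]
    simp_rw [add_comm (a * b)]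

theorem sum_range_addExp {e : ℕ} (he : e ≠ 0) (k : ℤ) :
    ∑ j ∈ Finset.range e, addExp e (k * j) = if (e : ℤ) ∣ k then (e : ℂ) else 0 := by
  have : NeZero e := ⟨he⟩
  rw [sum_range_eq_sum_zmod e (fun j => addExp e (k * j))]
  have h := AddChar.sum_mulShift (k : ZMod e) (ZMod.isPrimitive_stdAddChar e)
  rw [ZMod.card] at h
  simp_rw [addExp_eq_stdAddChar]
  simp only [Int.cast_mul, Int.cast_natCast, ZMod.natCast_zmod_val, mul_comm (k : ZMod e)]
  rw [h]
  simp only [ZMod.intCast_zmod_eq_zero_iff_dvd]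
  split_ifs <;> simp

theorem sum_units_zmod_eq_sum_range {c : ℕ} [NeZero c] (F : ZMod c → ℂ) :
    ∑ u : (ZMod c)ˣ, F u = ∑ x ∈ Finset.range c, if x.Coprime c then F x else 0 := by
  classical
  have h1 : ∑ x ∈ Finset.range c, (if x.Coprime c then F x else 0) =
      ∑ x : ZMod c, if IsUnit x then F x else 0 := by
    have := sum_range_eq_sum_zmod c (fun x => if IsUnit (x : ZMod c) then F x else 0)
    simp only [Int.cast_natCast, ZMod.natCast_zmod_val] at this
    rw [← this]
    simp only [ZMod.isUnit_iff_coprime]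
  rw [h1, ← Finset.sum_filter]
  refine Finset.sum_bij (fun u _ => (u : ZMod c)) (fun u _ => by simp)
    (fun u _ v _ h => Units.ext h) (fun x hx => ?_) fun u _ => rfl
  obtain ⟨u, hu⟩ := (Finset.mem_filter.mp hx).2
  exact ⟨u, Finset.mem_univ _, hu⟩

open ArithmeticFunction in
theorem sum_divisors_filter_moebius {c : ℕ} (hc : c ≠ 0) (x : ℕ) :
    ∑ d ∈ c.divisors, (if d ∣ x then (moebius d : ℤ) else 0) = if x.Coprime c then 1 else 0 := by
  have h1 : c.divisors.filter (· ∣ x) = (Nat.gcd x c).divisors := by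
    ext d
    simp only [Finset.mem_filter, Nat.mem_divisors, Nat.dvd_gcd_iff]
    have : Nat.gcd x c ≠ 0 := Nat.gcd_ne_zero_right hc
    tauto
  rw [← Finset.sum_filter, h1, ← coe_mul_zeta_apply, moebius_mul_coe_zeta, one_apply]

open ArithmeticFunction in
/-- The evaluation of Ramanujan sums. -/
theorem sum_units_stdAddChar_eq {c : ℕ} [NeZero c] (k : ℤ) :
    ∑ u : (ZMod c)ˣ, ZMod.stdAddChar ((k : ZMod c) * (u : ZMod c)) =
      ∑ δ ∈ c.divisors, if (δ : ℤ) ∣ k then (moebius (c / δ) : ℂ) * δ else 0 := by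
  have hc : c ≠ 0 := NeZero.ne c
  rw [sum_units_zmod_eq_sum_range (fun u => ZMod.stdAddChar ((k : ZMod c) * u)),
    ← Nat.sum_div_divisors c (fun δ => if (δ : ℤ) ∣ k then (moebius (c / δ) : ℂ) * δ else 0)]
  have h1 (x : ℕ) : (if x.Coprime c then ZMod.stdAddChar ((k : ZMod c) * (x : ZMod c)) else 0 : ℂ) =
      ∑ d ∈ c.divisors, if d ∣ x then (moebius d : ℂ) * addExp c (k * x) else 0 := by
    have h2 := congrArg (fun z : ℤ => (z : ℂ) * addExp c (k * x)) (sum_divisors_filter_moebius hc x)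
    push_cast at h2
    rw [Finset.sum_mul] at h2
    simp only [ite_mul, zero_mul, one_mul] at h2
    rw [h2, addExp_eq_stdAddChar]
    push_cast
    rfl
  simp_rw [h1]
  rw [Finset.sum_comm]
  refine Finset.sum_congr rfl fun d hd => ?_
  obtain ⟨e, rfl⟩ := Nat.dvd_of_mem_divisors hd
  have hd0 : d ≠ 0 := left_ne_zero_of_mul hc
  have he0 : e ≠ 0 := right_ne_zero_of_mul hc
  rw [Nat.mul_div_cancel_left _ (Nat.pos_of_ne_zero hd0), Nat.mul_div_cancel _ (Nat.pos_of_ne_zero he0),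
    sum_range_mul, Finset.sum_eq_single 0]
  · have h3 := sum_range_addExp he0 k
    have h4 : ∀ j ∈ Finset.range e, (if d ∣ 0 + d * j then (moebius d : ℂ) *
        addExp (d * e) (k * ((0 + d * j : ℕ) : ℤ)) else 0) = moebius d * addExp e (k * j) := by
      intro j _
      rw [if_pos (by simp), ← addExp_mul_mul hd0 e]
      congr 2
      push_cast; ring
    rw [Finset.sum_congr rfl h4, ← Finset.mul_sum, h3]
    split_ifs <;> simp
  · intro y hy hy0
    refine Finset.sum_eq_zero fun j _ => if_neg fun h => ?_
    have := (Nat.dvd_add_left (dvd_mul_right d j)).mp h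
    exact hy0 (Nat.eq_zero_of_dvd_of_lt this (Finset.mem_range.mp hy))
  · intro h; exact absurd (Finset.mem_range.mpr (Nat.pos_of_ne_zero hd0)) h

theorem card_divisors_mul_le (a b : ℕ) : (a * b).divisors.card ≤ a.divisors.card * b.divisors.card := by
  rw [Nat.divisors_mul]
  exact Finset.card_mul_le

theorem gcd_mul_of_isCoprime {a n : ℤ} (h : IsCoprime a n) (b : ℤ) : Int.gcd (a * b) n = Int.gcd b n :=
  Int.gcd_mul_right_left_of_gcd_eq_one (Int.isCoprime_iff_gcd_eq_one.mp h)

/-- The number of `y` modulo `12δ`, prime to `6`, with `K y² ≡ N` modulo `24δ`. -/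
theorem card_theta_congruence_le {δ : ℕ} (hδ : δ ≠ 0) {K N : ℤ} (hK : IsCoprime K (24 * δ : ℕ))
    (hN : N ≡ 1 [ZMOD 24]) :
    (((Finset.range (12 * δ)).filter fun y : ℕ => ((24 * δ : ℕ) : ℤ) ∣ N - K * (y : ℤ) ^ 2).card : ℝ) ≤
      16 * δ.divisors.card * √(Int.gcd N δ) := by
  have : NeZero (24 * δ) := ⟨by omega⟩
  have hKu : IsUnit (K : ZMod (24 * δ)) := isUnit_intCast_zmod_iff.mpr hK
  have h1 : ((Finset.range (12 * δ)).filter fun y : ℕ => ((24 * δ : ℕ) : ℤ) ∣ N - K * (y : ℤ) ^ 2).card ≤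
      (Finset.univ.filter fun x : ZMod (24 * δ) => x ^ 2 = ((K * N : ℤ) : ZMod (24 * δ))).card := by
    refine Finset.card_le_card_of_injOn (fun y : ℕ => (K : ZMod (24 * δ)) * (y : ZMod (24 * δ))) ?_ ?_
    · intro y hy
      rw [Finset.mem_coe, Finset.mem_filter, ← ZMod.intCast_zmod_eq_zero_iff_dvd] at hy
      rw [Finset.mem_coe, Finset.mem_filter]
      refine ⟨Finset.mem_univ _, ?_⟩
      have h2 := hy.2
      push_cast at h2 ⊢
      linear_combination (-(K : ZMod (24 * δ))) * h2
    · intro y hy y' hy' h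
      rw [Finset.mem_coe, Finset.mem_filter, Finset.mem_range] at hy hy'
      have h2 := hKu.mul_left_cancel h
      rw [ZMod.natCast_eq_natCast_iff'] at h2
      rwa [Nat.mod_eq_of_lt (by omega), Nat.mod_eq_of_lt (by omega)] at h2
  have h2 := card_sq_eq_le (24 * δ) (K * N)
  have h24 : IsCoprime (24 : ℤ) N := by
    obtain ⟨t, ht⟩ := hN.dvd
    exact ⟨t, 1, by linarith⟩
  have h3 : Int.gcd (K * N) (24 * δ : ℕ) = Int.gcd N δ := by
    rw [gcd_mul_of_isCoprime hK]
    push_cast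
    rw [Int.gcd_comm, gcd_mul_of_isCoprime h24, Int.gcd_comm]
  rw [h3] at h2
  have h4 : ((24 * δ).divisors.card : ℝ) ≤ 8 * δ.divisors.card := by
    have h := card_divisors_mul_le 24 δ
    rw [show Nat.divisors 24 = {1, 2, 3, 4, 6, 8, 12, 24} by decide] at h
    exact_mod_cast h
  refine (Nat.cast_le.mpr h1).trans (h2.trans ?_)
  refine mul_le_mul_of_nonneg_right ?_ (Real.sqrt_nonneg _)
  linarith

theorem kroneckerTwelve_add_mul (y : ℤ) (a : ℤ) : kroneckerTwelve (y + 12 * a) = kroneckerTwelve y :=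
  kroneckerTwelve_congr (Int.modEq_iff_dvd.mpr ⟨-a, by ring⟩)

/-- The exponential sum with the character `(12/·)` over the solutions of `K y² ≡ N` modulo `24δ`. It
vanishes unless `c / δ` divides the frequency `t`. -/
theorem norm_theta_congruence_sum_le {δ e : ℕ} (hδ : δ ≠ 0) (he : e ≠ 0) {K N t : ℤ}
    (hK : IsCoprime K (24 * δ : ℕ)) (hN : N ≡ 1 [ZMOD 24]) :
    ‖∑ y ∈ Finset.range (12 * (δ * e)), (if ((24 * δ : ℕ) : ℤ) ∣ N - K * (y : ℤ) ^ 2 then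
      (kroneckerTwelve y : ℂ) * addExp (12 * (δ * e)) (t * y) else 0)‖ ≤
      if (e : ℤ) ∣ t then e * (16 * δ.divisors.card * √(Int.gcd N δ)) else 0 := by
  have hper (y j : ℕ) : (if ((24 * δ : ℕ) : ℤ) ∣ N - K * ((y + 12 * δ * j : ℕ) : ℤ) ^ 2 then
      (kroneckerTwelve (y + 12 * δ * j : ℕ) : ℂ) * addExp (12 * (δ * e)) (t * (y + 12 * δ * j : ℕ)) else 0) =
      (if ((24 * δ : ℕ) : ℤ) ∣ N - K * (y : ℤ) ^ 2 then
        (kroneckerTwelve y : ℂ) * addExp (12 * (δ * e)) (t * y) else 0) * addExp e (t * j) := by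
    have h1 : ((24 * δ : ℕ) : ℤ) ∣ N - K * ((y + 12 * δ * j : ℕ) : ℤ) ^ 2 ↔
        ((24 * δ : ℕ) : ℤ) ∣ N - K * (y : ℤ) ^ 2 := by
      rw [show N - K * ((y + 12 * δ * j : ℕ) : ℤ) ^ 2 = N - K * (y : ℤ) ^ 2 -
        ((24 * δ : ℕ) : ℤ) * (K * (y * j + 6 * δ * j ^ 2)) by push_cast; ring]
      exact dvd_sub_left (dvd_mul_right _ _)
    have h2 : kroneckerTwelve ((y + 12 * δ * j : ℕ) : ℤ) = kroneckerTwelve y := by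
      rw [← kroneckerTwelve_add_mul y (δ * j)]
      congr 1; push_cast; ring
    have h3 : addExp (12 * (δ * e)) (t * (y + 12 * δ * j : ℕ)) =
        addExp (12 * (δ * e)) (t * y) * addExp e (t * j) := by
      rw [← addExp_mul_mul (k := 12 * δ) (by omega) e, mul_assoc 12 δ e, ← addExp_add]
      congr 1; push_cast; ring
    rw [h2, h3]
    simp only [h1]
    split_ifs <;> ring
  rw [← mul_assoc 12 δ e, sum_range_mul]
  simp_rw [mul_assoc 12 δ e]
  simp_rw [hper]
  simp_rw [← Finset.mul_sum, sum_range_addExp he]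
  split_ifs with h
  · rw [← Finset.sum_mul, norm_mul, Complex.norm_natCast, mul_comm]
    refine mul_le_mul_of_nonneg_left ?_ (Nat.cast_nonneg e)
    refine le_trans ?_ (card_theta_congruence_le hδ hK hN)
    rw [← Finset.sum_filter]
    refine (norm_sum_le_of_le _ (n := fun _ => (1 : ℝ)) fun y _ => ?_).trans (by simp)
    rw [norm_mul, norm_addExp, mul_one, Complex.norm_intCast]
    exact_mod_cast abs_kroneckerTwelve_le_one y
  · simp

/-- The part of the Kloosterman sum over the modulus prime to `M`. Ramanujan sums split it into sums over
the solutions of `K y² ≡ N` modulo `24δ`, and only the `δ ∣ c` with `c / δ ∣ t` contribute: this is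
the source of the number of divisors of `(t, c)`. -/
theorem norm_theta_ramanujan_sum_le {c : ℕ} [NeZero c] {K N t β : ℤ} (hK : IsCoprime K (24 * c : ℕ))
    (hβ : IsCoprime β c) (hK1 : K ≡ 1 [ZMOD 24]) (hN : N ≡ 1 [ZMOD 24]) :
    ‖∑ y ∈ Finset.range (12 * c), (kroneckerTwelve y : ℂ) * addExp (12 * c) (t * y) *
      ∑ u : (ZMod c)ˣ, ZMod.stdAddChar (((β * ((N - K * (y : ℤ) ^ 2) / 24) : ℤ) : ZMod c) * (u : ZMod c))‖ ≤
      16 * c * (Int.gcd t c).divisors.card * c.divisors.card * √(Int.gcd N c) := by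
  have hc : c ≠ 0 := NeZero.ne c
  have h1 (y : ℕ) : (kroneckerTwelve y : ℂ) * addExp (12 * c) (t * y) *
      ∑ u : (ZMod c)ˣ, ZMod.stdAddChar (((β * ((N - K * (y : ℤ) ^ 2) / 24) : ℤ) : ZMod c) * (u : ZMod c)) =
      ∑ δ ∈ c.divisors, (ArithmeticFunction.moebius (c / δ) : ℂ) * δ *
        (if ((24 * δ : ℕ) : ℤ) ∣ N - K * (y : ℤ) ^ 2 then
          (kroneckerTwelve y : ℂ) * addExp (12 * c) (t * y) else 0) := by
    rw [sum_units_stdAddChar_eq, Finset.mul_sum]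
    refine Finset.sum_congr rfl fun δ hδ => ?_
    by_cases hy : kroneckerTwelve (y : ℤ) = 0
    · simp [hy]
    have h24 : (24 : ℤ) ∣ N - K * (y : ℤ) ^ 2 := by
      refine Int.ModEq.dvd ?_
      have h := hK1.mul (sq_modEq_one_of_kroneckerTwelve_ne_zero hy)
      rw [mul_one] at h
      exact h.trans hN.symm
    obtain ⟨n, hn⟩ := h24
    rw [hn, Int.mul_ediv_cancel_left _ (by norm_num)]
    have hβδ : IsCoprime (δ : ℤ) β :=
      (hβ.of_isCoprime_of_dvd_right (Int.natCast_dvd_natCast.mpr (Nat.dvd_of_mem_divisors hδ))).symm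
    have h2 : (δ : ℤ) ∣ β * n ↔ ((24 * δ : ℕ) : ℤ) ∣ 24 * n := by
      push_cast
      rw [mul_dvd_mul_iff_left (by norm_num)]
      exact ⟨fun h => hβδ.dvd_of_dvd_mul_left h, fun h => h.mul_left β⟩
    simp only [h2]
    split_ifs <;> ring
  simp_rw [h1]
  rw [Finset.sum_comm]
  simp_rw [← Finset.mul_sum]
  have h2 : ∀ δ ∈ c.divisors, ‖(ArithmeticFunction.moebius (c / δ) : ℂ) * δ *
      ∑ y ∈ Finset.range (12 * c), (if ((24 * δ : ℕ) : ℤ) ∣ N - K * (y : ℤ) ^ 2 then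
          (kroneckerTwelve y : ℂ) * addExp (12 * c) (t * y) else 0)‖ ≤
      if ((c / δ : ℕ) : ℤ) ∣ t then 16 * c * c.divisors.card * √(Int.gcd N c) else 0 := by
    intro δ hδ
    obtain ⟨e, he⟩ := Nat.dvd_of_mem_divisors hδ
    have hδ0 : δ ≠ 0 := fun h => hc (by rw [he, h, zero_mul])
    have he0 : e ≠ 0 := fun h => hc (by rw [he, h, mul_zero])
    have hce : c / δ = e := by rw [he, Nat.mul_div_cancel_left _ (Nat.pos_of_ne_zero hδ0)]
    have hKδ : IsCoprime K (24 * δ : ℕ) := hK.of_isCoprime_of_dvd_right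
      (Int.natCast_dvd_natCast.mpr (Nat.mul_dvd_mul_left 24 ⟨e, he⟩))
    have h3 := norm_theta_congruence_sum_le hδ0 he0 (t := t) hKδ hN
    rw [← he] at h3
    rw [norm_mul, norm_mul, Complex.norm_natCast, hce]
    have hμ : ‖(ArithmeticFunction.moebius e : ℂ)‖ ≤ 1 := by
      rw [Complex.norm_intCast]
      exact_mod_cast ArithmeticFunction.abs_moebius_le_one
    have h4 : ‖(ArithmeticFunction.moebius e : ℂ)‖ * (δ : ℝ) ≤ δ :=
      mul_le_of_le_one_left (Nat.cast_nonneg δ) hμ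
    refine (mul_le_mul h4 h3 (norm_nonneg _) (Nat.cast_nonneg δ)).trans ?_
    split_ifs
    · have h5 : (δ.divisors.card : ℝ) ≤ c.divisors.card := by
        exact_mod_cast Finset.card_le_card (Nat.divisors_subset_of_dvd hc ⟨e, he⟩)
      have h6 : √(Int.gcd N δ : ℝ) ≤ √(Int.gcd N c) := by
        refine Real.sqrt_le_sqrt ?_
        exact_mod_cast Nat.le_of_dvd (Int.gcd_pos_of_ne_zero_right _ (by exact_mod_cast hc))
          (Int.gcd_dvd_gcd_of_dvd_right N (Int.natCast_dvd_natCast.mpr ⟨e, he⟩))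
      have h7 : (c : ℝ) = δ * e := by exact_mod_cast he
      calc (δ : ℝ) * (e * (16 * δ.divisors.card * √(Int.gcd N δ))) =
            (16 * c) * (δ.divisors.card * √(Int.gcd N δ)) := by rw [h7]; ring
        _ ≤ (16 * c) * (c.divisors.card * √(Int.gcd N c)) :=
            mul_le_mul_of_nonneg_left (mul_le_mul h5 h6 (Real.sqrt_nonneg _) (Nat.cast_nonneg _))
              (by positivity)
        _ = _ := by ring
    · simp
  refine (norm_sum_le_of_le _ h2).trans (le_of_eq ?_)
  rw [Nat.sum_div_divisors c (fun e => if (e : ℤ) ∣ t then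
    16 * (c : ℝ) * c.divisors.card * √(Int.gcd N c) else 0), ← Finset.sum_filter, Finset.sum_const]
  have h3 : c.divisors.filter (fun e : ℕ => (e : ℤ) ∣ t) = (Int.gcd t c).divisors := by
    ext e
    simp only [Finset.mem_filter, Nat.mem_divisors]
    have h0 : Int.gcd t c ≠ 0 := (Int.gcd_pos_of_ne_zero_right _ (by exact_mod_cast hc)).ne'
    rw [← Int.natCast_dvd_natCast (n := Int.gcd t c), Int.dvd_coe_gcd_iff, Int.natCast_dvd_natCast]
    tauto
  rw [h3, nsmul_eq_mul]
  ring

/-! ### Opening the Kloosterman sum -/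

/-- The matrices `γ` in the Kloosterman sum correspond to the units `d` modulo `c`, with `a = d⁻¹`. -/
theorem sum_kloostermanMatrices_eq {c : ℕ} [NeZero c] (F : ZMod c → ZMod c → ℂ) :
    ∑ γ ∈ (finite_kloostermanMatrices c).toFinset, F (γ 0 0 : ℤ) (γ 1 1 : ℤ) =
      ∑ u : (ZMod c)ˣ, F (u⁻¹ : (ZMod c)ˣ) u := by
  have hdet (γ : SL(2, ℤ)) (hγ : γ ∈ kloostermanMatrices c) : γ 0 0 * γ 1 1 - γ 0 1 * c = 1 := by
    have h := Matrix.SpecialLinearGroup.det_coe γ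
    rwa [Matrix.det_fin_two, hγ.1] at h
  have hmul (γ : SL(2, ℤ)) (hγ : γ ∈ kloostermanMatrices c) : ((γ 1 1 : ℤ) : ZMod c) * (γ 0 0 : ℤ) = 1 := by
    have h := congrArg (fun z : ℤ => (z : ZMod c)) (hdet γ hγ)
    push_cast at h
    rw [ZMod.natCast_self, mul_zero, sub_zero] at h
    rw [mul_comm]; exact h
  have hmem {γ : SL(2, ℤ)} (hγ : γ ∈ (finite_kloostermanMatrices c).toFinset) : γ ∈ kloostermanMatrices c :=
    (Set.Finite.mem_toFinset _).mp hγ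
  refine Finset.sum_bij (fun γ hγ => ⟨(γ 1 1 : ℤ), (γ 0 0 : ℤ), hmul γ (hmem hγ), by
    rw [mul_comm]; exact hmul γ (hmem hγ)⟩) (fun _ _ => Finset.mem_univ _) ?_ ?_ fun _ _ => rfl
  · intro γ hγ γ' hγ' h
    have hγ1 := hmem hγ
    have hγ2 := hmem hγ'
    have hd : ((γ 1 1 : ℤ) : ZMod c) = (γ' 1 1 : ℤ) := congrArg Units.val h
    have ha : ((γ 0 0 : ℤ) : ZMod c) = (γ' 0 0 : ℤ) := congrArg (fun u : (ZMod c)ˣ => ((u⁻¹ : (ZMod c)ˣ) : ZMod c)) h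
    rw [ZMod.intCast_eq_intCast_iff] at hd ha
    have e1 := hdet γ hγ1
    have e2 := hdet γ' hγ2
    obtain ⟨h0, a1, a2, d1, d2⟩ := hγ1
    obtain ⟨h0', a1', a2', d1', d2'⟩ := hγ2
    have hd' : γ 1 1 = γ' 1 1 := by
      rwa [Int.ModEq, Int.emod_eq_of_lt d1 d2, Int.emod_eq_of_lt d1' d2'] at hd
    have ha' : γ 0 0 = γ' 0 0 := by
      rwa [Int.ModEq, Int.emod_eq_of_lt a1 a2, Int.emod_eq_of_lt a1' a2'] at ha
    have hb : γ 0 1 = γ' 0 1 := by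
      refine mul_right_cancel₀ (show (c : ℤ) ≠ 0 by exact_mod_cast NeZero.ne c) ?_
      rw [hd', ha'] at e1
      linarith
    ext i j
    fin_cases i <;> fin_cases j
    · exact ha'
    · exact hb
    · exact h0.trans h0'.symm
    · exact hd'
  · intro u _
    set a : ℕ := ((u⁻¹ : (ZMod c)ˣ) : ZMod c).val
    set d : ℕ := (u : ZMod c).val
    have ha : (a : ZMod c) = ((u⁻¹ : (ZMod c)ˣ) : ZMod c) := ZMod.natCast_zmod_val _
    have hd : (d : ZMod c) = u := ZMod.natCast_zmod_val _
    obtain ⟨b, hb⟩ : (c : ℤ) ∣ a * d - 1 := by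
      rw [← ZMod.intCast_zmod_eq_zero_iff_dvd]
      push_cast
      rw [ha, hd, Units.inv_mul, sub_self]
    let γ : SL(2, ℤ) := ⟨!![(a : ℤ), b; (c : ℤ), (d : ℤ)], by
      rw [Matrix.det_fin_two_of]; linarith⟩
    have hγ : γ ∈ kloostermanMatrices c := by
      refine ⟨rfl, ?_, ?_, ?_, ?_⟩
      · exact Int.natCast_nonneg a
      · exact Int.ofNat_lt.mpr (ZMod.val_lt _)
      · exact Int.natCast_nonneg d
      · exact Int.ofNat_lt.mpr (ZMod.val_lt _)
    refine ⟨γ, (Set.Finite.mem_toFinset _).mpr hγ, Units.ext ?_⟩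
    change (((d : ℕ) : ℤ) : ZMod c) = u
    rw [Int.cast_natCast, hd]

/-- Opening the multiplier as a Gauss sum, with the coefficient of index `w` of the theta series and its
Galois twist by `k`. The integers `k` and `w` are free parameters, subject to congruence conditions. -/
theorem exists_etaKloostermanSum_eq {m n N v M x w : ℤ} {c k : ℕ} [NeZero c] (hk : k.Coprime (24 * c))
    (hk1 : (k : ℤ) ≡ 1 [ZMOD 24]) (hw : kroneckerTwelve w ≠ 0) (hn : 24 * n - 23 = N)
    (hm : 24 * m - 23 = v ^ 2 * M) (hx : v ^ 2 * M - k * w ^ 2 = 24 * x) :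
    ∃ κ : ℂ, ‖κ‖ = 1 / √(12 * c) ∧ etaKloostermanSum m n c =
      κ * ∑ r ∈ Finset.range (12 * c), (kroneckerTwelve r : ℂ) * addExp (12 * c) (k * w * r) *
        ∑ u : (ZMod c)ˣ, ZMod.stdAddChar ((x : ZMod c) * ((u⁻¹ : (ZMod c)ˣ) : ZMod c) +
          (((N - k * (r : ℤ) ^ 2) / 24 : ℤ) : ZMod c) * (u : ZMod c)) := by
  have hc : 0 < c := NeZero.pos c
  have hcC : (c : ℂ) ≠ 0 := by exact_mod_cast hc.ne'
  have hcR : (0 : ℝ) < c := by exact_mod_cast hc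
  obtain ⟨κ, hκ, h⟩ := exists_cuspGaussSum_eq_mul_conj_etaMultiplier hc hk hk1
  have hκ0 : κ ≠ 0 := by
    rw [← norm_ne_zero_iff, hκ]; exact (Real.sqrt_pos.mpr (by positivity)).ne'
  have hw2 : (kroneckerTwelve w : ℂ) ^ 2 = 1 := by exact_mod_cast kroneckerTwelve_sq_of_ne_zero hw
  have hw1 : ‖(kroneckerTwelve w : ℂ)‖ = 1 :=
    Complex.norm_eq_one_of_pow_eq_one hw2 two_ne_zero
  refine ⟨kroneckerTwelve w / κ, by rw [norm_div, hw1, hκ], ?_⟩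
  rw [etaKloostermanSum, Finset.mul_sum]
  have hterm (γ : SL(2, ℤ)) (hγ : γ ∈ (finite_kloostermanMatrices c).toFinset) :
      (starRingEnd ℂ) (etaMultiplier γ) * Complex.exp (2 * Real.pi * Complex.I *
        ((((m : ℂ) - 23 / 24) * (γ 0 0 : ℂ) + ((n : ℂ) - 23 / 24) * (γ 1 1 : ℂ)) / (c : ℂ))) =
      ∑ r ∈ Finset.range (12 * c), kroneckerTwelve w / κ * ((kroneckerTwelve r : ℂ) *
        addExp (12 * c) (k * w * r) * ZMod.stdAddChar ((x : ZMod c) * ((γ 0 0 : ℤ) : ZMod c) +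
          (((N - k * (r : ℤ) ^ 2) / 24 : ℤ) : ZMod c) * ((γ 1 1 : ℤ) : ZMod c))) := by
    have hγ0 : γ 1 0 = c := ((Set.Finite.mem_toFinset _).mp hγ).1
    set a := γ 0 0
    set d := γ 1 1
    have h1 : Complex.exp (2 * Real.pi * Complex.I *
        ((((m : ℂ) - 23 / 24) * (a : ℂ) + ((n : ℂ) - 23 / 24) * (d : ℂ)) / (c : ℂ))) =
        addExp (24 * c) (v ^ 2 * M * a + N * d) := by
      rw [addExp, ← hn, ← hm]
      congr 1
      push_cast
      field_simp
    have h2 : (starRingEnd ℂ) (etaMultiplier γ) =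
        kroneckerTwelve w / κ * addExp (24 * c) (-(k * (a * w ^ 2))) * cuspGaussSum c k d w := by
      rw [h γ hγ0 w, addExp_neg]
      have := addExp_ne_zero (24 * c) (k * (a * w ^ 2))
      field_simp
      rw [hw2, mul_one]
    rw [h1, h2, cuspGaussSum, Finset.mul_sum, Finset.sum_mul]
    refine Finset.sum_congr rfl fun r _ => ?_
    -- For `r` prime to `6` the division by `24` in the statement is exact.
    by_cases hr : kroneckerTwelve (r : ℤ) = 0
    · simp [hr]
    have h24 : (24 : ℤ) ∣ N - k * (r : ℤ) ^ 2 := by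
      refine Int.ModEq.dvd ?_
      have h := hk1.mul (sq_modEq_one_of_kroneckerTwelve_ne_zero hr)
      rw [mul_one] at h
      refine h.trans (Int.modEq_iff_dvd.mpr ⟨n - 1, ?_⟩)
      rw [← hn]; ring
    obtain ⟨y, hy⟩ := h24
    rw [hy, Int.mul_ediv_cancel_left _ (by norm_num)]
    have h3 : addExp (24 * c) (-(k * (a * w ^ 2))) * addExp (24 * c) (k * (-d * (r : ℤ) ^ 2 + 2 * w * r)) *
        addExp (24 * c) (v ^ 2 * M * a + N * d) = addExp (12 * c) (k * w * r) * addExp c (x * a + y * d) := by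
      rw [← addExp_mul_mul (k := 2) two_ne_zero (12 * c), ← addExp_mul_mul (k := 24) (by norm_num) c,
        ← mul_assoc 2 12 c, show 2 * 12 = 24 from rfl, ← addExp_add, ← addExp_add, ← addExp_add]
      congr 1
      push_cast
      linear_combination a * hx + d * hy
    have h4 := addExp_eq_stdAddChar c (x * a + y * d)
    push_cast at h4
    rw [← h4]
    linear_combination (kroneckerTwelve w / κ * kroneckerTwelve r : ℂ) * h3
  rw [Finset.sum_congr rfl hterm, Finset.sum_comm]
  refine Finset.sum_congr rfl fun r _ => ?_
  rw [← Finset.mul_sum, ← Finset.mul_sum]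
  congr 2
  exact sum_kloostermanMatrices_eq (fun α β => ZMod.stdAddChar ((x : ZMod c) * α +
    (((N - k * (r : ℤ) ^ 2) / 24 : ℤ) : ZMod c) * β))

/-! ### Factorization along coprime moduli -/

/-- The Chinese remainder theorem for sums over a period. -/
theorem sum_range_mul_of_coprime {α : Type*} [AddCommMonoid α] {a b : ℕ} (hab : a.Coprime b)
    (ha : a ≠ 0) (hb : b ≠ 0) {f : ℤ → α} (hf : ∀ x y : ℤ, x ≡ y [ZMOD (a * b : ℕ)] → f x = f y) :
    ∑ r ∈ Finset.range (a * b), f r =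
      ∑ y ∈ Finset.range a, ∑ z ∈ Finset.range b, f (b * y + a * z) := by
  have hpos : 0 < a * b := Nat.pos_of_ne_zero (mul_ne_zero ha hb)
  let g : ℕ × ℕ → ℕ := fun p => (b * p.1 + a * p.2) % (a * b)
  have hinj : Set.InjOn g (Finset.range a ×ˢ Finset.range b : Finset (ℕ × ℕ)) := by
    rintro ⟨y, z⟩ h ⟨y', z'⟩ h' hg
    simp only [Finset.coe_product, Set.mem_prod, Finset.mem_coe, Finset.mem_range] at h h'
    have hg' : b * y + a * z ≡ b * y' + a * z' [MOD a * b] := hg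
    have h1 : b * y ≡ b * y' [MOD a] := by
      have := hg'.of_mul_right b
      simpa [Nat.ModEq, Nat.add_mul_mod_self_left] using this
    have h2 : a * z ≡ a * z' [MOD b] := by
      have := hg'.of_mul_left a
      simpa [Nat.ModEq, Nat.mul_add_mod] using this
    have h3 := Nat.ModEq.cancel_left_of_coprime hab h1
    have h4 := Nat.ModEq.cancel_left_of_coprime hab.symm h2
    rw [Nat.ModEq, Nat.mod_eq_of_lt h.1, Nat.mod_eq_of_lt h'.1] at h3
    rw [Nat.ModEq, Nat.mod_eq_of_lt h.2, Nat.mod_eq_of_lt h'.2] at h4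
    rw [h3, h4]
  have himg : (Finset.range a ×ˢ Finset.range b).image g = Finset.range (a * b) := by
    refine Finset.eq_of_subset_of_card_le ?_ ?_
    · intro r hr
      obtain ⟨p, -, rfl⟩ := Finset.mem_image.mp hr
      exact Finset.mem_range.mpr (Nat.mod_lt _ hpos)
    · rw [Finset.card_image_of_injOn hinj]
      simp
  rw [← himg, Finset.sum_image hinj, Finset.sum_product]
  refine Finset.sum_congr rfl fun y _ => Finset.sum_congr rfl fun z _ => hf _ _ ?_
  simp only [g]
  push_cast
  exact Int.mod_modEq _ _

/-- The Chinese remainder theorem for sums over units. -/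
theorem sum_units_zmod_mul {a b : ℕ} [NeZero a] [NeZero b] [NeZero (a * b)] (hab : a.Coprime b)
    (F : ZMod a → ZMod a → ℂ) (G : ZMod b → ZMod b → ℂ) :
    ∑ u : (ZMod (a * b))ˣ,
      F (ZMod.castHom (dvd_mul_right a b) (ZMod a) ((u⁻¹ : (ZMod (a * b))ˣ) : ZMod (a * b)))
        (ZMod.castHom (dvd_mul_right a b) (ZMod a) u) *
      G (ZMod.castHom (dvd_mul_left b a) (ZMod b) ((u⁻¹ : (ZMod (a * b))ˣ) : ZMod (a * b)))
        (ZMod.castHom (dvd_mul_left b a) (ZMod b) u) =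
      (∑ u : (ZMod a)ˣ, F ((u⁻¹ : (ZMod a)ˣ) : ZMod a) u) *
        ∑ u : (ZMod b)ˣ, G ((u⁻¹ : (ZMod b)ˣ) : ZMod b) u := by
  rw [Fintype.sum_mul_sum, ← Fintype.sum_prod_type']
  let e := (Units.mapEquiv (ZMod.chineseRemainder hab).toMulEquiv).trans MulEquiv.prodUnits
  have h1 : ZMod.castHom (dvd_mul_right a b) (ZMod a) =
      (RingHom.fst (ZMod a) (ZMod b)).comp (ZMod.chineseRemainder hab).toRingHom := Subsingleton.elim _ _
  have h2 : ZMod.castHom (dvd_mul_left b a) (ZMod b) =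
      (RingHom.snd (ZMod a) (ZMod b)).comp (ZMod.chineseRemainder hab).toRingHom := Subsingleton.elim _ _
  refine Fintype.sum_equiv e.toEquiv _ _ fun u => ?_
  have h3 (u : (ZMod (a * b))ˣ) : ((e u).1 : ZMod a) = ZMod.castHom (dvd_mul_right a b) (ZMod a) u := by
    rw [h1]; rfl
  have h4 (u : (ZMod (a * b))ˣ) : ((e u).2 : ZMod b) = ZMod.castHom (dvd_mul_left b a) (ZMod b) u := by
    rw [h2]; rfl
  rw [← h3, ← h3, ← h4, ← h4, map_inv]
  rfl

/-- The partial fraction `1 / (a b) = s / a + t / b` for additive characters. -/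
theorem stdAddChar_mul_eq {a b : ℕ} [NeZero a] [NeZero b] [NeZero (a * b)] {s t : ℤ} (h : s * b + t * a = 1)
    (x : ZMod (a * b)) : ZMod.stdAddChar x =
      ZMod.stdAddChar ((s : ZMod a) * ZMod.castHom (dvd_mul_right a b) (ZMod a) x) *
        ZMod.stdAddChar ((t : ZMod b) * ZMod.castHom (dvd_mul_left b a) (ZMod b) x) := by
  obtain ⟨n, rfl⟩ := ZMod.intCast_surjective x
  rw [map_intCast (ZMod.castHom (dvd_mul_right a b) (ZMod a)),
    map_intCast (ZMod.castHom (dvd_mul_left b a) (ZMod b)), ← Int.cast_mul, ← Int.cast_mul, ← addExp_eq_stdAddChar,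
    ← addExp_eq_stdAddChar, ← addExp_eq_stdAddChar, ← addExp_mul_mul (NeZero.ne b) a,
    ← addExp_mul_mul (NeZero.ne a) b, mul_comm b a, ← addExp_add]
  congr 1
  linear_combination (-n) * h

theorem exists_natCast_modEq {a b : ℕ} (hab : a.Coprime b) (ha : a ≠ 0) (hb : b ≠ 0) (x y : ℤ) :
    ∃ k : ℕ, (k : ℤ) ≡ x [ZMOD a] ∧ (k : ℤ) ≡ y [ZMOD b] := by
  obtain ⟨k, h1, h2⟩ := Nat.chineseRemainder hab (x % a).toNat (y % b).toNat
  have hx := Int.toNat_of_nonneg (Int.emod_nonneg x (show (a : ℤ) ≠ 0 by exact_mod_cast ha))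
  have hy := Int.toNat_of_nonneg (Int.emod_nonneg y (show (b : ℤ) ≠ 0 by exact_mod_cast hb))
  have h1' := Int.natCast_modEq_iff.mpr h1
  have h2' := Int.natCast_modEq_iff.mpr h2
  rw [hx] at h1'
  rw [hy] at h2'
  exact ⟨k, h1'.trans (Int.mod_modEq x a), h2'.trans (Int.mod_modEq y b)⟩

/-- Factorization of the opened Kloosterman sum along `c = c₁ c₂`, into a sum of Ramanujan sums modulo
`c₁` and a Salié-type sum modulo `c₂`, when the parameters satisfy `c₁ ∣ x` and `c₂ ∣ w`. -/
theorem theta_kloosterman_sum_factor {c₁ c₂ : ℕ} [NeZero c₁] [NeZero c₂] [NeZero (c₁ * c₂)]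
    (hcop : (24 * c₁).Coprime c₂) {K N w l k s t : ℤ} (hst : s * c₂ + t * c₁ = 1)
    (hK : K ≡ 1 [ZMOD 24]) (hN : N ≡ 1 [ZMOD 24]) (hw : (c₂ : ℤ) ∣ w) (hk : 24 * c₁ * k ≡ N [ZMOD c₂]) :
    ∑ r ∈ Finset.range (12 * (c₁ * c₂)), (kroneckerTwelve r : ℂ) * addExp (12 * (c₁ * c₂)) (K * w * r) *
        ∑ u : (ZMod (c₁ * c₂))ˣ, ZMod.stdAddChar (((c₁ * l : ℤ) : ZMod (c₁ * c₂)) *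
          ((u⁻¹ : (ZMod (c₁ * c₂))ˣ) : ZMod (c₁ * c₂)) +
          (((N - K * (r : ℤ) ^ 2) / 24 : ℤ) : ZMod (c₁ * c₂)) * (u : ZMod (c₁ * c₂))) =
      kroneckerTwelve c₂ * (∑ y ∈ Finset.range (12 * c₁), (kroneckerTwelve y : ℂ) * addExp (12 * c₁) (K * w * y) *
        ∑ u : (ZMod c₁)ˣ, ZMod.stdAddChar (((s * ((N - K * c₂ ^ 2 * (y : ℤ) ^ 2) / 24) : ℤ) : ZMod c₁) *
          (u : ZMod c₁))) * salieSum c₂ ((-6 * K * c₁ : ℤ) : ZMod c₂) l k := by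
  have hc₁ : c₁ ≠ 0 := NeZero.ne c₁
  have hc₂ : c₂ ≠ 0 := NeZero.ne c₂
  have h24 {r : ℤ} (hr : kroneckerTwelve r ≠ 0) : ∃ n, N - K * r ^ 2 = 24 * n := by
    have h := hK.mul (sq_modEq_one_of_kroneckerTwelve_ne_zero hr)
    rw [mul_one] at h
    exact (h.trans hN.symm).dvd
  let φ : ℤ → ℂ := fun r => (kroneckerTwelve r : ℂ) * addExp (12 * (c₁ * c₂)) (K * w * r) *
        ∑ u : (ZMod (c₁ * c₂))ˣ, ZMod.stdAddChar (((c₁ * l : ℤ) : ZMod (c₁ * c₂)) *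
          ((u⁻¹ : (ZMod (c₁ * c₂))ˣ) : ZMod (c₁ * c₂)) +
          (((N - K * r ^ 2) / 24 : ℤ) : ZMod (c₁ * c₂)) * (u : ZMod (c₁ * c₂)))
  have hφ (x y : ℤ) (hxy : x ≡ y [ZMOD (12 * c₁ * c₂ : ℕ)]) : φ x = φ y := by
    have h12 : kroneckerTwelve x = kroneckerTwelve y :=
      kroneckerTwelve_congr (hxy.of_dvd ⟨c₁ * c₂, by push_cast; ring⟩)
    simp only [φ]
    by_cases hx : kroneckerTwelve x = 0
    · rw [← h12, hx]; simp
    obtain ⟨n, hn⟩ := h24 hx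
    obtain ⟨n', hn'⟩ := h24 (h12 ▸ hx)
    rw [hn, hn', Int.mul_ediv_cancel_left _ (by norm_num), Int.mul_ediv_cancel_left _ (by norm_num), h12]
    have h1 : addExp (12 * (c₁ * c₂)) (K * w * x) = addExp (12 * (c₁ * c₂)) (K * w * y) :=
      addExp_congr (by rw [← mul_assoc 12 c₁ c₂]; exact hxy.mul_left _)
    have h2 : (n : ZMod (c₁ * c₂)) = n' := by
      rw [ZMod.intCast_eq_intCast_iff]
      obtain ⟨j, hj⟩ := hxy.dvd
      refine Int.modEq_iff_dvd.mpr ⟨-K * (x * j + 6 * c₁ * c₂ * j ^ 2), ?_⟩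
      obtain rfl : y = x + 12 * c₁ * c₂ * j := by push_cast at hj; linarith
      push_cast
      refine mul_left_cancel₀ (show (24 : ℤ) ≠ 0 by norm_num) ?_
      linear_combination hn - hn'
    rw [h1, h2]
  have h12 : (12 * c₁).Coprime c₂ :=
    Nat.Coprime.coprime_dvd_left ⟨2, by ring⟩ hcop
  have hc12 : c₁.Coprime c₂ := Nat.Coprime.coprime_dvd_left ⟨24, by ring⟩ hcop
  have hcrt := sum_range_mul_of_coprime h12 (by omega) hc₂ hφ
  rw [mul_assoc 12 c₁ c₂] at hcrt
  refine hcrt.trans ?_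
  -- The inner sum over units at `r = c₂ y + 12 c₁ z`.
  have hterm (y z : ℕ) : φ (c₂ * y + (12 * c₁ : ℕ) * z) = kroneckerTwelve c₂ *
      ((kroneckerTwelve y : ℂ) * addExp (12 * c₁) (K * w * y) *
        ∑ u : (ZMod c₁)ˣ, ZMod.stdAddChar (((s * ((N - K * c₂ ^ 2 * (y : ℤ) ^ 2) / 24) : ℤ) : ZMod c₁) *
          (u : ZMod c₁))) * ∑ u : (ZMod c₂)ˣ, (ZMod.stdAddChar (((-6 * K * c₁ : ℤ) : ZMod c₂) * (z : ZMod c₂) ^ 2 *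
            (u : ZMod c₂)) * ZMod.stdAddChar ((l : ZMod c₂) * ((u⁻¹ : (ZMod c₂)ˣ) : ZMod c₂) +
            (k : ZMod c₂) * (u : ZMod c₂))) := by
    have hχ : kroneckerTwelve (c₂ * y + (12 * c₁ : ℕ) * z) = kroneckerTwelve c₂ * kroneckerTwelve y := by
      rw [← kroneckerTwelve_mul, ← kroneckerTwelve_add_mul (c₂ * y) (c₁ * z)]
      congr 1; push_cast; ring
    simp only [φ]
    -- If `y` or `c₂` is not prime to `6` then both sides vanish; otherwise all divisions by `24` are exact.
    by_cases hy : kroneckerTwelve (y : ℤ) = 0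
    · rw [hχ, hy]; simp
    by_cases hc2 : kroneckerTwelve (c₂ : ℤ) = 0
    · rw [hχ, hc2]; simp
    obtain ⟨n, hn⟩ := h24 (show kroneckerTwelve (c₂ * y + (12 * c₁ : ℕ) * z) ≠ 0 by
      rw [hχ]; exact mul_ne_zero hc2 hy)
    obtain ⟨n', hn'⟩ := h24 (show kroneckerTwelve (c₂ * y) ≠ 0 by
      rw [kroneckerTwelve_mul]; exact mul_ne_zero hc2 hy)
    rw [show K * (c₂ : ℤ) ^ 2 * (y : ℤ) ^ 2 = K * (c₂ * y) ^ 2 by ring, hn, hn', hχ,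
      Int.mul_ediv_cancel_left _ (by norm_num), Int.mul_ediv_cancel_left _ (by norm_num)]
    have he : addExp (12 * (c₁ * c₂)) (K * w * (c₂ * y + (12 * c₁ : ℕ) * z)) = addExp (12 * c₁) (K * w * y) := by
      obtain ⟨w', rfl⟩ := hw
      rw [← addExp_mul_mul hc₂ (12 * c₁), show c₂ * (12 * c₁) = 12 * (c₁ * c₂) by ring]
      refine addExp_congr (Int.modEq_iff_dvd.mpr ⟨-(K * w' * z), ?_⟩)
      push_cast; ring
    have hnn : n = n' - K * (c₁ * c₂ * y * z + 6 * c₁ ^ 2 * z ^ 2) := by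
      refine mul_left_cancel₀ (show (24 : ℤ) ≠ 0 by norm_num) ?_
      rw [← hn, mul_sub, ← hn']
      push_cast; ring
    have hn1 : (n : ZMod c₁) = n' := by
      rw [hnn]; push_cast; rw [ZMod.natCast_self]; ring
    have hst2 : (t : ZMod c₂) * c₁ = 1 := by
      have h := congrArg (fun z : ℤ => (z : ZMod c₂)) hst
      push_cast at h
      rwa [ZMod.natCast_self, mul_zero, zero_add] at h
    have hunit : IsUnit ((24 * c₁ : ℕ) : ZMod c₂) := (ZMod.isUnit_iff_coprime _ _).mpr hcop
    have hn2' : (t : ZMod c₂) * n' = k := by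
      refine hunit.mul_left_cancel ?_
      have h1 : ((24 * c₁ * k : ℤ) : ZMod c₂) = (N : ℤ) := (ZMod.intCast_eq_intCast_iff _ _ _).mpr hk
      have h2 := congrArg (fun z : ℤ => (z : ZMod c₂)) hn'
      push_cast at h1 h2 ⊢
      rw [ZMod.natCast_self] at h2
      linear_combination (24 * (n' : ZMod c₂)) * hst2 - h1 - h2
    have hn2 : (t : ZMod c₂) * n = k + ((-6 * K * c₁ : ℤ) : ZMod c₂) * (z : ZMod c₂) ^ 2 := by
      rw [hnn]
      push_cast
      rw [ZMod.natCast_self]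
      linear_combination hn2' - 6 * K * c₁ * (z : ZMod c₂) ^ 2 * hst2
    have hunits := sum_units_zmod_mul hc12
      (fun α β => ZMod.stdAddChar ((s : ZMod c₁) * (((c₁ * l : ℤ) : ZMod c₁) * α + (n : ZMod c₁) * β)))
      (fun α β => ZMod.stdAddChar ((t : ZMod c₂) * (((c₁ * l : ℤ) : ZMod c₂) * α + (n : ZMod c₂) * β)))
    have hL : ∑ u : (ZMod (c₁ * c₂))ˣ, ZMod.stdAddChar (((c₁ * l : ℤ) : ZMod (c₁ * c₂)) *
          ((u⁻¹ : (ZMod (c₁ * c₂))ˣ) : ZMod (c₁ * c₂)) + (n : ZMod (c₁ * c₂)) * (u : ZMod (c₁ * c₂))) =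
        (∑ u : (ZMod c₁)ˣ, ZMod.stdAddChar (((s * n' : ℤ) : ZMod c₁) * (u : ZMod c₁))) *
        ∑ u : (ZMod c₂)ˣ, (ZMod.stdAddChar (((-6 * K * c₁ : ℤ) : ZMod c₂) * (z : ZMod c₂) ^ 2 *
            (u : ZMod c₂)) * ZMod.stdAddChar ((l : ZMod c₂) * ((u⁻¹ : (ZMod c₂)ˣ) : ZMod c₂) +
            (k : ZMod c₂) * (u : ZMod c₂))) := by
      refine (Finset.sum_congr rfl fun u _ => ?_).trans (hunits.trans (congrArg₂ _ ?_ ?_))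
      · rw [stdAddChar_mul_eq hst]
        simp only [map_add, map_mul, map_intCast]
      · refine Finset.sum_congr rfl fun u _ => ?_
        congr 1
        rw [hn1]
        push_cast
        rw [ZMod.natCast_self]
        ring
      · refine Finset.sum_congr rfl fun u _ => ?_
        rw [← AddChar.map_add_eq_mul]
        congr 1
        have h1 : (t : ZMod c₂) * ((c₁ * l : ℤ) : ZMod c₂) = l := by
          push_cast; linear_combination (l : ZMod c₂) * hst2
        linear_combination ((u⁻¹ : (ZMod c₂)ˣ) : ZMod c₂) * h1 + (u : ZMod c₂) * hn2
    rw [hL, he]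
    push_cast
    ring
  simp_rw [hterm]
  simp_rw [← Finset.mul_sum]
  rw [← Finset.sum_mul, ← Finset.mul_sum]
  congr 1
  rw [salieSum, Finset.sum_comm]
  refine Finset.sum_congr rfl fun u _ => ?_
  rw [← Finset.sum_mul]
  congr 1
  have := sum_range_eq_sum_zmod c₂ (fun z : ℤ => ZMod.stdAddChar (((-6 * K * c₁ : ℤ) : ZMod c₂) *
    (z : ZMod c₂) ^ 2 * (u : ZMod c₂)))
  simpa only [Int.cast_natCast, ZMod.natCast_zmod_val] using this

/-! ### The bound -/

theorem squarefree_dvd_of_forall_prime {r m : ℕ} (hr : Squarefree r)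
    (h : ∀ p : ℕ, p.Prime → p ∣ r → p ∣ m) : r ∣ m := by
  rw [← Nat.prod_primeFactors_of_squarefree hr]
  refine Finset.prod_primes_dvd m (fun p hp => (Nat.prime_of_mem_primeFactors hp).prime) fun p hp => ?_
  exact h p (Nat.prime_of_mem_primeFactors hp) (Nat.dvd_of_mem_primeFactors hp)

theorem proposition2p1 :
    ∃ C : ℝ, 0 < C ∧
      ∀ (m n N M v : ℤ) (c : ℕ), 1 ≤ c →
        24 * n - 23 = N → 24 * m - 23 = v ^ 2 * M → Squarefree M →
        ‖etaKloostermanSum m n c‖ ≤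
          C * ((Int.gcd v (c : ℤ)).divisors.card : ℝ) * (c.divisors.card : ℝ) *
            Real.sqrt (Int.gcd (M * N) (c : ℤ) : ℝ) * Real.sqrt (c : ℝ) := by
  refine ⟨32, by norm_num, fun m n N M v c hc hn hm hM => ?_⟩
  have hc0 : c ≠ 0 := by omega
  -- `c = c₂ c₁` with `c₁` prime to `M`, and `c₂` composed of primes dividing `M`
  obtain ⟨c₂, c₁, hcc, hc₁M, hc21, hc₂M⟩ := exists_mul_coprime_of_ne_zero M.natAbs hc0
  rw [mul_comm] at hcc
  have hc₁0 : c₁ ≠ 0 := fun h => hc0 (by rw [hcc, h, zero_mul])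
  have hc₂0 : c₂ ≠ 0 := fun h => hc0 (by rw [hcc, h, mul_zero])
  have : NeZero c₁ := ⟨hc₁0⟩
  have : NeZero c₂ := ⟨hc₂0⟩
  have : NeZero c := ⟨hc0⟩
  have : NeZero (c₁ * c₂) := ⟨mul_ne_zero hc₁0 hc₂0⟩
  have hN1 : N ≡ 1 [ZMOD 24] := Int.modEq_iff_dvd.mpr ⟨1 - n, by rw [← hn]; ring⟩
  -- Since `v² M ≡ 1` modulo `24` and squares of units modulo `24` are `1`, also `M ≡ 1` modulo `24`.
  have hv24 : IsCoprime v 24 := ⟨v * M, 1 - m, by linear_combination -hm⟩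
  have hv2 : v ^ 2 ≡ 1 [ZMOD 24] :=
    sq_modEq_one_of_kroneckerTwelve_ne_zero (kroneckerTwelve_ne_zero_of_isCoprime hv24)
  have hM1 : M ≡ 1 [ZMOD 24] := by
    have h1 := (hv2.mul_right M).symm
    rw [one_mul, ← hm] at h1
    exact h1.trans (Int.modEq_iff_dvd.mpr ⟨1 - m, by ring⟩)
  have hM24 : IsCoprime M 24 := by
    obtain ⟨t, ht⟩ := hM1.dvd
    exact ⟨1, t, by linarith⟩
  have hc₂24 : c₂.Coprime 24 := by
    refine Nat.coprime_of_dvd fun p hp h1 h2 => ?_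
    have h3 : (p : ℤ) ∣ M := Int.natCast_dvd.mpr (hc₂M p hp h1)
    have h4 := hM24.isUnit_of_dvd' h3 (by exact_mod_cast h2)
    exact hp.one_lt.ne' (by simpa using Int.isUnit_iff_natAbs_eq.mp h4)
  have hcop : (24 * c₁).Coprime c₂ := Nat.Coprime.mul_left hc₂24.symm hc21.symm
  have h24c₁ : 24 * c₁ ≠ 0 := by omega
  -- Modulo `24 c₁` the choice `K ≡ M`, `w ≡ v` makes `v² M - K w²` vanish, which leaves Ramanujan sums
  -- modulo `c₁`. Modulo `c₂`, where `M` need not be a unit, `K ≡ 1` keeps `K` prime to `c`, and `w ≡ 0`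
  -- removes the linear phase, so that the sum over `r` there is a pure quadratic Gauss sum.
  obtain ⟨K, hK1, hK2⟩ := exists_natCast_modEq hcop h24c₁ hc₂0 M 1
  obtain ⟨w, hw1, hw2⟩ := exists_natCast_modEq hcop h24c₁ hc₂0 v 0
  have hd24 : (24 : ℤ) ∣ (24 * c₁ : ℕ) := ⟨c₁, by push_cast; ring⟩
  have hK24 : (K : ℤ) ≡ 1 [ZMOD 24] := (hK1.of_dvd hd24).trans hM1
  have hw24 : IsCoprime (w : ℤ) 24 := by
    obtain ⟨t, ht⟩ := (hw1.of_dvd hd24).dvd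
    rw [show (w : ℤ) = v + 24 * -t by linarith]
    exact hv24.add_mul_left_left _
  have hψw : kroneckerTwelve w ≠ 0 := kroneckerTwelve_ne_zero_of_isCoprime hw24
  have hMc₁ : IsCoprime M c₁ := by
    rw [Int.isCoprime_iff_gcd_eq_one, Int.gcd_comm]
    exact hc₁M
  have hK24c₁ : IsCoprime (K : ℤ) (24 * c₁ : ℕ) := by
    obtain ⟨t, ht⟩ := hK1.dvd
    rw [show (K : ℤ) = M + (24 * c₁ : ℕ) * -t by linarith]
    refine IsCoprime.add_mul_left_left ?_ _
    push_cast
    exact hM24.mul_right hMc₁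
  have hKc₂ : IsCoprime (K : ℤ) c₂ := by
    obtain ⟨t, ht⟩ := hK2.dvd
    exact ⟨1, t, by linarith⟩
  have hKc : K.Coprime (24 * c) := by
    rw [hcc, ← mul_assoc]
    exact Nat.Coprime.mul_right (Nat.isCoprime_iff_coprime.mp hK24c₁) (Nat.isCoprime_iff_coprime.mp hKc₂)
  obtain ⟨l, hl⟩ : ((24 * c₁ : ℕ) : ℤ) ∣ v ^ 2 * M - K * w ^ 2 := by
    refine Int.ModEq.dvd ?_
    rw [mul_comm (v ^ 2)]
    exact hK1.mul (hw1.pow 2)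
  obtain ⟨κ, hκ, hS⟩ := exists_etaKloostermanSum_eq (x := c₁ * l) hKc hK24 hψw hn hm
    (by rw [hl]; push_cast; ring)
  obtain ⟨s, t, hst⟩ : IsCoprime (c₂ : ℤ) c₁ := Nat.isCoprime_iff_coprime.mpr hc21
  obtain ⟨k, hk⟩ : ∃ k : ℤ, 24 * c₁ * k ≡ N [ZMOD c₂] := by
    obtain ⟨α, β, h⟩ : IsCoprime ((24 * c₁ : ℕ) : ℤ) c₂ := Nat.isCoprime_iff_coprime.mpr hcop
    refine ⟨α * N, Int.modEq_iff_dvd.mpr ⟨β * N, ?_⟩⟩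
    push_cast at h
    linear_combination -N * h
  subst hcc
  rw [theta_kloosterman_sum_factor hcop hst hK24 hN1 (by simpa using hw2.symm.dvd) hk] at hS
  have hsc₁ : IsCoprime s (c₁ : ℤ) := ⟨c₂, t, by linarith⟩
  have hc₂sq : (c₂ : ℤ) ^ 2 ≡ 1 [ZMOD 24] := sq_modEq_one_of_kroneckerTwelve_ne_zero
    (kroneckerTwelve_ne_zero_of_isCoprime (by exact_mod_cast Nat.isCoprime_iff_coprime.mpr hc₂24))
  have hKc₂2 : IsCoprime ((K : ℤ) * c₂ ^ 2) (24 * c₁ : ℕ) :=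
    hK24c₁.mul_left (IsCoprime.pow_left (Nat.isCoprime_iff_coprime.mpr hcop.symm))
  have hR := norm_theta_ramanujan_sum_le (t := K * w) hKc₂2 hsc₁ (by simpa using hK24.mul hc₂sq) hN1
  have h2u : IsUnit (2 : ZMod c₂) := by
    have := (ZMod.isUnit_iff_coprime 2 c₂).mpr (Nat.Coprime.coprime_dvd_left (by norm_num) hc₂24.symm)
    exact_mod_cast this
  have hbu : IsUnit ((-6 * K * c₁ : ℤ) : ZMod c₂) := by
    rw [isUnit_intCast_zmod_iff]
    have h6 : IsCoprime (-6 : ℤ) c₂ := by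
      rw [IsCoprime.neg_left_iff]
      exact Nat.isCoprime_iff_coprime.mpr (Nat.Coprime.coprime_dvd_left (by norm_num) hc₂24.symm)
    exact (h6.mul_left hKc₂).mul_left (Nat.isCoprime_iff_coprime.mpr hc21.symm)
  obtain ⟨r₁, hr₁, hgr, hT⟩ := exists_norm_salieSum_le h2u hbu l k
  set g := Int.gcd (Int.gcd l k) c₂
  -- The gcd factors of the two parts combine into `(MN, c)`: here `g` divides `N`, and `r₁`, being
  -- squarefree and composed of primes dividing `M`, divides `M`.
  have hgcd : Int.gcd N c₁ * (g * r₁) ∣ Int.gcd (M * N) (c₁ * c₂ : ℕ) := by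
    have hgN : (g : ℤ) ∣ N := by
      have h1 : (g : ℤ) ∣ k := (Int.gcd_dvd_left _ _).trans (Int.gcd_dvd_right _ _)
      have h2 : (g : ℤ) ∣ c₂ := Int.gcd_dvd_right _ _
      have h3 := dvd_add (h1.mul_left (24 * c₁)) (h2.trans hk.dvd)
      simpa using h3
    have hr₁M : (r₁ : ℤ) ∣ M := by
      rw [Int.natCast_dvd]
      exact squarefree_dvd_of_forall_prime hr₁ fun p hp h =>
        hc₂M p hp (h.trans ((dvd_mul_left r₁ g).trans hgr))
    refine Nat.Coprime.mul_dvd_of_dvd_of_dvd ?_ ?_ ?_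
    · exact (hc21.symm.coprime_dvd_left (by exact_mod_cast Int.gcd_dvd_right N (c₁ : ℤ))).coprime_dvd_right hgr
    · refine Int.dvd_gcd ((Int.gcd_dvd_left _ _).mul_left M) ((Int.gcd_dvd_right N (c₁ : ℤ)).trans ?_)
      exact ⟨c₂, by push_cast; ring⟩
    · refine Int.dvd_gcd ?_ ?_
      · rw [mul_comm M]
        push_cast
        exact mul_dvd_mul hgN hr₁M
      · exact Int.natCast_dvd_natCast.mpr (hgr.mul_left c₁)
  have hgcdR : √(Int.gcd N c₁ : ℝ) * √(g * r₁) ≤ √(Int.gcd (M * N) (c₁ * c₂ : ℕ) : ℝ) := by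
    rw [← Real.sqrt_mul (Nat.cast_nonneg _)]
    refine Real.sqrt_le_sqrt ?_
    exact_mod_cast Nat.le_of_dvd (Int.gcd_pos_of_ne_zero_right _ (by exact_mod_cast hc0)) hgcd
  -- The frequency `K w` has the same greatest common divisor with `c₁` as `v`.
  have hdiv : ((Int.gcd (K * w) c₁).divisors.card : ℝ) ≤ (Int.gcd v (c₁ * c₂ : ℕ)).divisors.card := by
    have h0 : Int.gcd v (c₁ * c₂ : ℕ) ≠ 0 := (Int.gcd_pos_of_ne_zero_right _ (by exact_mod_cast hc0)).ne'
    refine Nat.cast_le.mpr (Finset.card_le_card (Nat.divisors_subset_of_dvd h0 ?_))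
    have hKc₁ : IsCoprime (K : ℤ) c₁ := hK24c₁.of_isCoprime_of_dvd_right ⟨24, by push_cast; ring⟩
    rw [gcd_mul_of_isCoprime hKc₁]
    have h1 : ((Int.gcd w c₁ : ℕ) : ℤ) ∣ c₁ := Int.gcd_dvd_right _ _
    have h2 : ((Int.gcd w c₁ : ℕ) : ℤ) ∣ v := by
      have h3 := (h1.trans ⟨24, by push_cast; ring⟩ : _ ∣ ((24 * c₁ : ℕ) : ℤ)).trans hw1.dvd
      simpa using dvd_add h3 (Int.gcd_dvd_left w (c₁ : ℤ))
    exact Int.dvd_gcd h2 (h1.trans ⟨c₂, by push_cast; ring⟩)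
  have hcR : (0 : ℝ) < ((c₁ * c₂ : ℕ) : ℝ) := by exact_mod_cast hc
  have hτ : ((c₁ * c₂).divisors.card : ℝ) = c₁.divisors.card * c₂.divisors.card := by
    exact_mod_cast hc21.symm.card_divisors_mul
  have hχ : ‖(kroneckerTwelve c₂ : ℂ)‖ ≤ 1 := by
    rw [Complex.norm_intCast]; exact_mod_cast abs_kroneckerTwelve_le_one _
  have hκ' : ‖κ‖ * (c₁ * c₂ : ℕ) ≤ √((c₁ * c₂ : ℕ) : ℝ) := by
    rw [hκ, one_div, inv_mul_le_iff₀ (Real.sqrt_pos.mpr (by positivity))]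
    calc ((c₁ * c₂ : ℕ) : ℝ) = √((c₁ * c₂ : ℕ) : ℝ) * √((c₁ * c₂ : ℕ) : ℝ) :=
          (Real.mul_self_sqrt hcR.le).symm
      _ ≤ √(12 * ((c₁ * c₂ : ℕ) : ℝ)) * √((c₁ * c₂ : ℕ) : ℝ) := by
          refine mul_le_mul_of_nonneg_right (Real.sqrt_le_sqrt ?_) (Real.sqrt_nonneg _)
          linarith
  rw [hS, norm_mul, norm_mul, norm_mul]
  set T1 := ((Int.gcd (K * w) c₁).divisors.card : ℝ)
  set T := ((Int.gcd v (c₁ * c₂ : ℕ)).divisors.card : ℝ)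
  set D1 := (c₁.divisors.card : ℝ)
  set D2 := (c₂.divisors.card : ℝ)
  have hT1 : 0 ≤ T1 := Nat.cast_nonneg _
  have hD1 : 0 ≤ D1 := Nat.cast_nonneg _
  have hD2 : 0 ≤ D2 := Nat.cast_nonneg _
  rw [hτ]
  calc _ ≤ ‖κ‖ * (1 * (16 * c₁ * T1 * D1 * √(Int.gcd N c₁)) * (2 * D2 * c₂ * √(g * r₁))) := by
        refine mul_le_mul_of_nonneg_left ?_ (norm_nonneg _)
        exact mul_le_mul (mul_le_mul hχ hR (norm_nonneg _) zero_le_one) hT (norm_nonneg _)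
          (by positivity)
    _ = 32 * (T1 * (D1 * D2) * (√(Int.gcd N c₁) * √(g * r₁)) * (‖κ‖ * (c₁ * c₂ : ℕ))) := by
        push_cast; ring
    _ ≤ 32 * (T * (D1 * D2) * √(Int.gcd (M * N) (c₁ * c₂ : ℕ)) * √((c₁ * c₂ : ℕ) : ℝ)) := by
        gcongr
    _ = _ := by ring
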